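/- A communicating timed automaton (CTA) with global clocks consists of finitely many discrete timed automata $A_1,\dots,A_n$, a finite message alphabet $\Sigma$, finitely many directed FIFO channels (at most one channel $c_{i,j}$ from $A_i$ to $A_j$), pairwise disjoint finite sets $\mathcal X_i$ of local clocks (which only $A_i$ can check and reset) and a finite set $\mathcal G$ of global clocks (which every automaton can check and reset). Each $A_i$ has a finite set $L_i$ of locations, sets $L_i^0,F_i\subseteq L_i$ of initial and final locations, and finitely many transitions $(\ell,g,op,Y,\ell')$, where $g$ is a finite conjunction of constraints $x\bowtie k$ with $x\in\mathcal X_i\cup\mathcal G$, $k\in\mathbb N$, ${\bowtie}\in\{<,\le,=,>,\ge\}$, where $Y\subseteq\mathcal X_i\cup\mathcal G$ is the set of clocks to be reset to $0$, and where $op$ is the empty operation, or $c_{i,j}!a$ (append the message $a\in\Sigma$ with age $0$ to the tail of $c_{i,j}$), or $c_{j,i}?(a\in I)$ (remove the message at the head of $c_{j,i}$, provided that it is $a$ and that its age lies in $I$; here $I$ is an interval with end points in $\mathbb N$, or with upper end $\infty$, each end open or closed). A configuration consists of a location for each automaton, values in $\mathbb N$ for all clocks, and for each channel a word of messages with ages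 in $\mathbb N$ (no message being older than one written before it). A step of the CTA either lets a time $t\in\mathbb N$ pass, which adds $t$ to all clocks and to the ages of all messages in the channels, or executes one transition of one automaton whose guard is satisfied. In an initial configuration each $A_i$ is in a location of $L_i^0$, all clocks are $0$ and all channels are empty. **Theorem 1.** In the presence of global clocks, reachability is undecidable for CTA that consist of two timed automata $A_1,A_2$ and a single channel, from $A_1$ to $A_2$. That is, neither of the following problems, whose inputs contain such a CTA $\mathcal N$ with global clocks and an initial configuration $\gamma_0$ of $\mathcal N$, is decidable: (a) given also $i\in\{1,2\}$ and a location $\ell\in L_i$, can a configuration in which $A_i$ is in location $\ell$ be reached from $\gamma_0$ (control location reachability)? (b) given also a configuration $\gamma$ of $\mathcal N$, can $\gamma$ be reached from $\gamma_0$ (configuration reachability)? -/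

import Mathlib

namespace CommTA

/-! ### Syntax

All finite sets (locations, clocks, messages, automata) are initial segments of `ℕ`; finite
subsets and finite conjunctions are lists. -/

/-- A clock as seen from one automaton: one of its own clocks, or a global clock. -/
inductive Clock where
  | own (x : ℕ)
  | glob (x : ℕ)
deriving DecidableEq

/-- The comparison symbols `<, ≤, =, >, ≥`. -/
inductive Cmp where
  | lt | le | eq | gt | ge
deriving DecidableEq

/-- The meaning of a comparison symbol. -/
def Cmp.Holds : Cmp → ℕ → ℕ → Prop
  | .lt, a, k => a < k
  | .le, a, k => a ≤ k
  | .eq, a, k => a = k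
  | .gt, a, k => k < a
  | .ge, a, k => k ≤ a

/-- An atomic clock constraint `clock cmp const`. -/
structure Constraint where
  clock : Clock
  cmp : Cmp
  const : ℕ

/-- An interval of ages, each end open or closed; the upper end `none` stands for `∞`. -/
structure AgeInterval where
  lo : ℕ
  loClosed : Bool
  hi : Option ℕ
  hiClosed : Bool

/-- `I.Mem t` means `t ∈ I`. -/
def AgeInterval.Mem (I : AgeInterval) (t : ℕ) : Prop :=
  (I.lo < t ∨ (I.loClosed = true ∧ t = I.lo)) ∧
    ∀ u ∈ I.hi, t < u ∨ (I.hiClosed = true ∧ t = u)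

/-- Channel operations of automaton number `i`: the empty operation, writing message `a` to the
channel from `i` to `j`, and reading message `a`, with age in `I`, from the channel from `j`
to `i`. -/
inductive Op where
  | nop
  | send (j a : ℕ)
  | recv (j a : ℕ) (I : AgeInterval)

/-- A transition `(src, guard, op, resets, dst)`; the guard is the conjunction of its entries. -/
structure Edge where
  src : ℕ
  guard : List Constraint
  op : Op
  resets : List Clock
  dst : ℕ

/-- A discrete timed automaton with locations `0, …, numLoc - 1` and own (local) clocks
`0, …, numClocks - 1`. -/
structure TimedAutomaton where
  numLoc : ℕ
  init : List ℕ
  numClocks : ℕ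
  edges : List Edge
  final : List ℕ

/-- A communicating timed automaton with global clocks `0, …, numGlobal - 1` and messages
`0, …, numMsg - 1`; `(i, j) ∈ channels` means that there is a channel from automaton `i` to
automaton `j`. -/
structure CTA where
  automata : List TimedAutomaton
  channels : List (ℕ × ℕ)
  numMsg : ℕ
  numGlobal : ℕ

/-! ### Well-formedness -/

/-- The clocks that automaton `A` of `N` may check and reset: its own and the global ones. -/
def CTA.ClockOK (N : CTA) (A : TimedAutomaton) : Clock → Prop
  | .own x => x < A.numClocks
  | .glob x => x < N.numGlobal

/-- The channel operations that automaton number `i` of `N` may use. -/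
def CTA.OpOK (N : CTA) (i : ℕ) : Op → Prop
  | .nop => True
  | .send j a => (i, j) ∈ N.channels ∧ a < N.numMsg
  | .recv j a _ => (j, i) ∈ N.channels ∧ a < N.numMsg

/-- All locations, clocks, channels and messages that occur in `N` exist in `N`, and there is at
most one channel from one automaton to another. -/
structure CTA.WellFormed (N : CTA) : Prop where
  channels_nodup : N.channels.Nodup
  channels_lt : ∀ c ∈ N.channels, c.1 < N.automata.length ∧ c.2 < N.automata.length
  init_lt : ∀ A ∈ N.automata, ∀ l ∈ A.init, l < A.numLoc
  final_lt : ∀ A ∈ N.automata, ∀ l ∈ A.final, l < A.numLoc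
  edge_lt : ∀ A ∈ N.automata, ∀ e ∈ A.edges, e.src < A.numLoc ∧ e.dst < A.numLoc
  guard_ok : ∀ A ∈ N.automata, ∀ e ∈ A.edges, ∀ c ∈ e.guard, N.ClockOK A c.clock
  resets_ok : ∀ A ∈ N.automata, ∀ e ∈ A.edges, ∀ x ∈ e.resets, N.ClockOK A x
  op_ok : ∀ i A, N.automata[i]? = some A → ∀ e ∈ A.edges, N.OpOK i e.op

/-- A (well-formed) CTA that consists of two automata, numbers `0` and `1`, and of one channel,
which leads from automaton `0` to automaton `1`. -/
structure CTA.TwoOneChannel (N : CTA) : Prop where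
  wellFormed : N.WellFormed
  two : N.automata.length = 2
  one : N.channels = [(0, 1)]

/-! ### Semantics -/

/-- A configuration: control locations, values of the local clocks (`ownVal i x` for clock `x` of
automaton `i`) and of the global clocks, and channel contents.  A channel content is a word of
messages with their ages; as new messages enter on the left, the leftmost letter is the newest
message (the tail of the queue), and the rightmost one is the oldest (the head of the queue).
Components with an index outside the ranges of a CTA have no meaning for it. -/
structure Config where
  loc : ℕ → ℕ
  ownVal : ℕ → ℕ → ℕ
  globVal : ℕ → ℕ
  chan : ℕ × ℕ → List (ℕ × ℕ)

/-- The value of a clock as seen from automaton number `i`. -/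
def Config.clockVal (γ : Config) (i : ℕ) : Clock → ℕ
  | .own x => γ.ownVal i x
  | .glob x => γ.globVal x

/-- The guard `g` of a transition of automaton number `i` is satisfied. -/
def Config.Sat (γ : Config) (i : ℕ) (g : List Constraint) : Prop :=
  ∀ c ∈ g, c.cmp.Holds (γ.clockVal i c.clock) c.const

/-- Time passes by `t`: all clocks and the ages of all messages grow by `t`. -/
def Config.elapse (γ : Config) (t : ℕ) : Config where
  loc := γ.loc
  ownVal := fun i x => γ.ownVal i x + t
  globVal := fun x => γ.globVal x + t
  chan := fun c => (γ.chan c).map fun p => (p.1, p.2 + t)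

/-- The effect of the transition `e` of automaton number `i` on locations and clocks. -/
def Config.move (γ : Config) (i : ℕ) (e : Edge) : Config where
  loc := Function.update γ.loc i e.dst
  ownVal := fun k x => if k = i ∧ Clock.own x ∈ e.resets then 0 else γ.ownVal k x
  globVal := fun x => if Clock.glob x ∈ e.resets then 0 else γ.globVal x
  chan := γ.chan

/-- The content of channel `c` is replaced by `w`. -/
def Config.setChan (γ : Config) (c : ℕ × ℕ) (w : List (ℕ × ℕ)) : Config :=
  { γ with chan := Function.update γ.chan c w }

/-- `e` is a transition of automaton number `i` that is enabled as far as the location and the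
clocks are concerned. -/
def CTA.Enabled (N : CTA) (γ : Config) (i : ℕ) (e : Edge) : Prop :=
  (∃ A, N.automata[i]? = some A ∧ e ∈ A.edges) ∧ γ.loc i = e.src ∧ γ.Sat i e.guard

/-- The transition relation: timed transitions and the three kinds of discrete transitions. -/
inductive CTA.Step (N : CTA) : Config → Config → Prop
  | time (γ : Config) (t : ℕ) : N.Step γ (γ.elapse t)
  | nop (γ : Config) (i : ℕ) (e : Edge) (h : N.Enabled γ i e) (hop : e.op = .nop) :
      N.Step γ (γ.move i e)
  | send (γ : Config) (i : ℕ) (e : Edge) (j a : ℕ) (h : N.Enabled γ i e)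
      (hop : e.op = .send j a) :
      N.Step γ ((γ.move i e).setChan (i, j) ((a, 0) :: γ.chan (i, j)))
  | recv (γ : Config) (i : ℕ) (e : Edge) (j a : ℕ) (I : AgeInterval) (w : List (ℕ × ℕ)) (t : ℕ)
      (h : N.Enabled γ i e) (hop : e.op = .recv j a I) (hw : γ.chan (j, i) = w ++ [(a, t)])
      (ht : I.Mem t) :
      N.Step γ ((γ.move i e).setChan (j, i) w)

/-- The configuration with the locations `start`, all clocks `0` and all channels empty. -/
def initial (start : List ℕ) : Config where
  loc := fun i => start.getD i 0
  ownVal := fun _ _ => 0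
  globVal := fun _ => 0
  chan := fun _ => []

/-- `start` picks one initial location for each automaton of `N`. -/
def CTA.IsStart (N : CTA) (start : List ℕ) : Prop :=
  List.Forall₂ (fun l A => l ∈ A.init) start N.automata

/-- `γ` can be reached in `N` from the initial configuration with the locations `start`. -/
def CTA.Reaches (N : CTA) (start : List ℕ) (γ : Config) : Prop :=
  Relation.ReflTransGen N.Step (initial start) γ

/-- `γ` is a configuration of `N`: the locations and messages exist, and no message is older than
one that was written before it. -/
structure CTA.IsConfig (N : CTA) (γ : Config) : Prop where
  loc_lt : ∀ i A, N.automata[i]? = some A → γ.loc i < A.numLoc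
  msg_lt : ∀ c ∈ N.channels, ∀ p ∈ γ.chan c, p.1 < N.numMsg
  ages : ∀ c ∈ N.channels, ((γ.chan c).map Prod.snd).Pairwise (· ≤ ·)

/-- The finite data of which a configuration consists: the locations, the values of the local
clocks of each automaton, the values of the global clocks, and the contents of the channels. -/
structure ConfigData where
  locs : List ℕ
  ownVals : List (List ℕ)
  globVals : List ℕ
  chans : List (List (ℕ × ℕ))

/-- The data of a configuration, restricted to the automata, clocks and channels of `N`. -/
def CTA.data (N : CTA) (γ : Config) : ConfigData where
  locs := (List.range N.automata.length).map γ.loc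
  ownVals := N.automata.mapIdx fun i A => (List.range A.numClocks).map (γ.ownVal i)
  globVals := (List.range N.numGlobal).map γ.globVal
  chans := N.channels.map γ.chan

/-! ### The objects above as inputs of algorithms -/

def Clock.equiv : Clock ≃ ℕ ⊕ ℕ where
  toFun | .own x => .inl x | .glob x => .inr x
  invFun | .inl x => .own x | .inr x => .glob x
  left_inv c := by cases c <;> rfl
  right_inv c := by cases c <;> rfl

def Cmp.equiv : Cmp ≃ Fin 5 where
  toFun | .lt => 0 | .le => 1 | .eq => 2 | .gt => 3 | .ge => 4
  invFun | 0 => .lt | 1 => .le | 2 => .eq | 3 => .gt | 4 => .ge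
  left_inv c := by cases c <;> rfl
  right_inv c := by fin_cases c <;> rfl

def Constraint.equiv : Constraint ≃ Clock × Cmp × ℕ where
  toFun c := (c.clock, c.cmp, c.const)
  invFun p := ⟨p.1, p.2.1, p.2.2⟩

def AgeInterval.equiv : AgeInterval ≃ ℕ × Bool × Option ℕ × Bool where
  toFun I := (I.lo, I.loClosed, I.hi, I.hiClosed)
  invFun p := ⟨p.1, p.2.1, p.2.2.1, p.2.2.2⟩

def Op.equiv : Op ≃ Unit ⊕ ((ℕ × ℕ) ⊕ (ℕ × ℕ × AgeInterval)) where
  toFun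
    | .nop => .inl ()
    | .send j a => .inr (.inl (j, a))
    | .recv j a I => .inr (.inr (j, a, I))
  invFun
    | .inl _ => .nop
    | .inr (.inl p) => .send p.1 p.2
    | .inr (.inr p) => .recv p.1 p.2.1 p.2.2
  left_inv o := by cases o <;> rfl
  right_inv o := by rcases o with _ | _ | _ <;> rfl

def Edge.equiv : Edge ≃ ℕ × List Constraint × Op × List Clock × ℕ where
  toFun e := (e.src, e.guard, e.op, e.resets, e.dst)
  invFun p := ⟨p.1, p.2.1, p.2.2.1, p.2.2.2.1, p.2.2.2.2⟩

def TimedAutomaton.equiv : TimedAutomaton ≃ ℕ × List ℕ × ℕ × List Edge × List ℕ where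
  toFun A := (A.numLoc, A.init, A.numClocks, A.edges, A.final)
  invFun p := ⟨p.1, p.2.1, p.2.2.1, p.2.2.2.1, p.2.2.2.2⟩

def CTA.equiv : CTA ≃ List TimedAutomaton × List (ℕ × ℕ) × ℕ × ℕ where
  toFun N := (N.automata, N.channels, N.numMsg, N.numGlobal)
  invFun p := ⟨p.1, p.2.1, p.2.2.1, p.2.2.2⟩

def ConfigData.equiv :
    ConfigData ≃ List ℕ × List (List ℕ) × List ℕ × List (List (ℕ × ℕ)) where
  toFun d := (d.locs, d.ownVals, d.globVals, d.chans)
  invFun p := ⟨p.1, p.2.1, p.2.2.1, p.2.2.2⟩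

instance : Primcodable Clock := Primcodable.ofEquiv _ Clock.equiv
instance : Primcodable Cmp := Primcodable.ofEquiv _ Cmp.equiv
instance : Primcodable Constraint := Primcodable.ofEquiv _ Constraint.equiv
instance : Primcodable AgeInterval := Primcodable.ofEquiv _ AgeInterval.equiv
instance : Primcodable Op := Primcodable.ofEquiv _ Op.equiv
instance : Primcodable Edge := Primcodable.ofEquiv _ Edge.equiv
instance : Primcodable TimedAutomaton := Primcodable.ofEquiv _ TimedAutomaton.equiv
instance : Primcodable CTA := Primcodable.ofEquiv _ CTA.equiv
instance : Primcodable ConfigData := Primcodable.ofEquiv _ ConfigData.equiv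

/-! ### The reachability problem -/

/-- Some algorithm that always terminates decides `p` on all inputs that satisfy `valid` (its
answers on other inputs are arbitrary). -/
def DecidableOn {α : Type*} [Primcodable α] (valid p : α → Prop) : Prop :=
  ∃ f : α → Bool, Computable f ∧ ∀ x, valid x → (f x = true ↔ p x)

/-- An input of the control location reachability problem: a CTA, a choice of initial locations,
the number of an automaton, and a location of this automaton. -/
structure LocInstance where
  cta : CTA
  start : List ℕ
  aut : ℕ
  target : ℕ

/-- An input of the configuration reachability problem: a CTA, a choice of initial locations,
and a configuration. -/
structure ConfigInstance where
  cta : CTA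
  start : List ℕ
  target : ConfigData

def LocInstance.equiv : LocInstance ≃ CTA × List ℕ × ℕ × ℕ where
  toFun p := (p.cta, p.start, p.aut, p.target)
  invFun p := ⟨p.1, p.2.1, p.2.2.1, p.2.2.2⟩

def ConfigInstance.equiv : ConfigInstance ≃ CTA × List ℕ × ConfigData where
  toFun p := (p.cta, p.start, p.target)
  invFun p := ⟨p.1, p.2.1, p.2.2⟩

instance : Primcodable LocInstance := Primcodable.ofEquiv _ LocInstance.equiv
instance : Primcodable ConfigInstance := Primcodable.ofEquiv _ ConfigInstance.equiv

/-- The inputs with a CTA of two automata and one channel between them. -/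
def LocInstance.Valid (p : LocInstance) : Prop :=
  p.cta.TwoOneChannel ∧ p.cta.IsStart p.start ∧
    ∃ A, p.cta.automata[p.aut]? = some A ∧ p.target < A.numLoc

/-- The control location is reachable, with whatever other locations, clock values and channel
contents. -/
def LocInstance.Reachable (p : LocInstance) : Prop :=
  ∃ γ, p.cta.Reaches p.start γ ∧ γ.loc p.aut = p.target

/-- The inputs with a CTA of two automata and one channel between them. -/
def ConfigInstance.Valid (p : ConfigInstance) : Prop :=
  p.cta.TwoOneChannel ∧ p.cta.IsStart p.start ∧
    ∃ γ, p.cta.IsConfig γ ∧ p.cta.data γ = p.target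

/-- The configuration is reachable. -/
def ConfigInstance.Reachable (p : ConfigInstance) : Prop :=
  ∃ γ, p.cta.Reaches p.start γ ∧ p.cta.data γ = p.target

end CommTA

namespace CommTA

/-! A finite control with one unbounded FIFO queue is Turing powerful, and two timed automata joined
by one channel can imitate it once global clocks let the receiver answer the sender. The channel is
the queue and the first automaton is the control; it performs the writes itself. A read of `a` is a
handshake at a single moment. The first automaton checks that clock `m` is positive, resets clock
`a` and waits. The second automaton can read `a` only while clock `a` is 0 and clock `m` is
positive, and it answers by resetting clock `m`. The first automaton goes on when it sees clock `m`
at 0. A delay during the handshake makes every clock positive, and then both automata are stuck for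
ever; it can lose a run but never falsify one. Soundness is the invariant `SimInv` (`SimInv.step`);
completeness is `Represents.step`.

Undecidability comes from one fixed program that runs program number `n` on input 0
(`exists_code_halting`). Mathlib turns it into a machine with several stacks. All stacks are kept in
one queue, each letter tagged with its stack, and a stack is accessed by rotating the queue once
past an end marker (`simulator_run`). The number `n` enters only through a word that the queue
system writes at the start, so the automata are a primitive recursive function of `n`.

The halting state empties the queue, and after each simulated step all clocks can be 0. Halting is
therefore equivalent to reaching a location and also to reaching one particular configuration, so
the same reduction serves both problems. -/

/-! ### Queue systems -/

/-- The operation of a transition of a queue system. -/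
inductive QueueOp where
  | jump
  | write (a : ℕ)
  | read (a : ℕ)

/-- A transition of a queue system. -/
structure QueueEdge where
  src : ℕ
  op : QueueOp
  dst : ℕ

/-- The letters that an operation uses are smaller than `m`. -/
def QueueOp.LettersLT (m : ℕ) : QueueOp → Prop
  | .jump => True
  | .write a => a < m
  | .read a => a < m

/-- The effect of an operation on the queue, whose head is the first entry of the list. -/
inductive QueueOp.Act : QueueOp → List ℕ → List ℕ → Prop
  | jump (w : List ℕ) : QueueOp.Act .jump w w
  | write (a : ℕ) (w : List ℕ) : QueueOp.Act (.write a) w (w ++ [a])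
  | read (a : ℕ) (w : List ℕ) : QueueOp.Act (.read a) (a :: w) w

/-- The transition relation of the queue system with the transitions `E`. -/
def QueueStep (E : List QueueEdge) (c d : ℕ × List ℕ) : Prop :=
  ∃ e ∈ E, e.src = c.1 ∧ e.dst = d.1 ∧ e.op.Act c.2 d.2

/-- Reachability in the queue system with the transitions `E`. -/
abbrev QueueReaches (E : List QueueEdge) : ℕ × List ℕ → ℕ × List ℕ → Prop :=
  Relation.ReflTransGen (QueueStep E)

/-! ### Simulation of queue systems by communicating timed automata

The first automaton writes letters itself. In order to read the letter `a`, it resets the global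
clock `a`, whereupon the second automaton must read `a` and reset the global clock `m`
at the same time. State `q` of the queue system corresponds to location `2 * q`; in location
`2 * q + 1` the first automaton waits until a letter has been read. -/

/-- All clocks of the simulation of a queue system with `m` letters. -/
def allClocks (m : ℕ) : List Clock :=
  (List.range (m + 1)).map .glob

/-- The transitions of the first automaton that simulate a transition of a queue system. -/
def QueueEdge.edges (m : ℕ) : QueueEdge → List Edge
  | ⟨s, .jump, d⟩ => [⟨2 * s, [], .nop, allClocks m, 2 * d⟩]
  | ⟨s, .write a, d⟩ => [⟨2 * s, [], .send 1 a, allClocks m, 2 * d⟩]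
  | ⟨s, .read a, d⟩ =>
    [⟨2 * s, [⟨.glob m, .ge, 1⟩], .nop, [.glob a], 2 * d + 1⟩,
      ⟨2 * d + 1, [⟨.glob m, .eq, 0⟩], .nop, allClocks m, 2 * d⟩]

/-- The interval of all ages. -/
def anyAge : AgeInterval := ⟨0, true, none, false⟩

theorem anyAge_mem (t : ℕ) : anyAge.Mem t := by
  refine ⟨?_, by simp [anyAge]⟩
  rcases Nat.eq_zero_or_pos t with h | h
  · exact Or.inr ⟨rfl, h⟩
  · exact Or.inl h

/-- The transition by which the second automaton reads the letter `a`. -/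
def readEdge (m a : ℕ) : Edge :=
  ⟨0, [⟨.glob a, .eq, 0⟩, ⟨.glob m, .ge, 1⟩], .recv 0 a anyAge, [.glob m], 0⟩

/-- The second automaton. -/
def reader (m : ℕ) : TimedAutomaton :=
  ⟨1, [0], 0, (List.range m).map (readEdge m), []⟩

/-- The first automaton, with the initial state `q` and the transitions `E`. -/
def writer (n q : ℕ) (E : List Edge) : TimedAutomaton :=
  ⟨2 * n, [2 * q], 0, E, []⟩

/-- The pair of the automata above. -/
def queueCTA (m n q : ℕ) (E : List Edge) : CTA :=
  ⟨[writer n q E, reader m], [(0, 1)], m, m + 1⟩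

/-- The transitions of a queue system use the states below `n` and the letters below `m`. -/
def Bounded (m n : ℕ) (E : List QueueEdge) : Prop :=
  ∀ e ∈ E, e.src < n ∧ e.dst < n ∧ e.op.LettersLT m

/-! ### Well-formedness of the simulating automata -/

theorem mem_allClocks {m x : ℕ} : Clock.glob x ∈ allClocks m ↔ x ≤ m := by
  simp [allClocks]

theorem queueCTA_twoOneChannel {m n q : ℕ} {E : List QueueEdge} (hE : Bounded m n E)
    (hq : q < n) : (queueCTA m n q (E.flatMap (QueueEdge.edges m))).TwoOneChannel := by
  have hclk : ∀ A : TimedAutomaton, ∀ x ∈ allClocks m,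
      (queueCTA m n q (E.flatMap (QueueEdge.edges m))).ClockOK A x := by
    intro A x hx
    simp only [allClocks, List.mem_map, List.mem_range] at hx
    obtain ⟨y, hy, rfl⟩ := hx
    exact hy
  have key : ∀ e ∈ E.flatMap (QueueEdge.edges m), e.src < 2 * n ∧ e.dst < 2 * n ∧
      (∀ c ∈ e.guard, c.clock ∈ allClocks m) ∧ (∀ x ∈ e.resets, x ∈ allClocks m) ∧
      (e.op = .nop ∨ ∃ a < m, e.op = .send 1 a) := by
    intro e he
    obtain ⟨⟨s, o, d⟩, h, he⟩ := List.mem_flatMap.1 he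
    obtain ⟨h1, h2, h3⟩ := hE _ h
    simp only at h1 h2
    cases o with
    | jump =>
      simp only [QueueEdge.edges, List.mem_singleton] at he
      subst he
      refine ⟨by simp; omega, by simp; omega, by simp, by simp, by simp⟩
    | write a =>
      simp only [QueueEdge.edges, List.mem_singleton] at he
      subst he
      refine ⟨by simp; omega, by simp; omega, by simp, by simp, Or.inr ⟨a, h3, rfl⟩⟩
    | read a =>
      have h3 : a < m := h3
      simp only [QueueEdge.edges, List.mem_cons, List.not_mem_nil, or_false] at he
      rcases he with rfl | rfl
      · refine ⟨by simp; omega, by simp; omega, by simp [mem_allClocks], ?_, by simp⟩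
        simp [mem_allClocks, h3.le]
      · refine ⟨by simp; omega, by simp; omega, by simp [mem_allClocks], by simp, by simp⟩
  have rkey : ∀ e ∈ (reader m).edges, e.src < 1 ∧ e.dst < 1 ∧
      (∀ c ∈ e.guard, c.clock ∈ allClocks m) ∧ (∀ x ∈ e.resets, x ∈ allClocks m) ∧
      (∃ a < m, e.op = .recv 0 a anyAge) := by
    intro e he
    simp only [reader, List.mem_map, List.mem_range] at he
    obtain ⟨a, ha, rfl⟩ := he
    refine ⟨by simp [readEdge], by simp [readEdge], ?_, ?_, a, ha, rfl⟩
    · simp [readEdge, mem_allClocks, ha.le]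
    · simp [readEdge, mem_allClocks]
  refine ⟨⟨?_, ?_, ?_, ?_, ?_, ?_, ?_, ?_⟩, rfl, rfl⟩
  · simp [queueCTA]
  · simp [queueCTA]
  · simp [queueCTA, writer, reader, hq]
  · simp [queueCTA, writer, reader]
  · intro A hA e he
    simp only [queueCTA, List.mem_cons, List.not_mem_nil, or_false] at hA
    rcases hA with rfl | rfl
    · exact ⟨(key e he).1, (key e he).2.1⟩
    · exact ⟨(rkey e he).1, (rkey e he).2.1⟩
  · intro A hA e he c hc
    apply hclk
    simp only [queueCTA, List.mem_cons, List.not_mem_nil, or_false] at hA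
    rcases hA with rfl | rfl
    · exact (key e he).2.2.1 c hc
    · exact (rkey e he).2.2.1 c hc
  · intro A hA e he x hx
    apply hclk
    simp only [queueCTA, List.mem_cons, List.not_mem_nil, or_false] at hA
    rcases hA with rfl | rfl
    · exact (key e he).2.2.2.1 x hx
    · exact (rkey e he).2.2.2.1 x hx
  · intro i A hA e he
    rcases i with _ | _ | i
    · simp only [queueCTA, List.getElem?_cons_zero, Option.some.injEq] at hA
      subst hA
      rcases (key e he).2.2.2.2 with h | ⟨a, ha, h⟩
      · rw [h]; trivial
      · rw [h]; exact ⟨by simp [queueCTA], ha⟩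
    · simp only [queueCTA, zero_add, List.getElem?_cons_succ, List.getElem?_cons_zero,
        Option.some.injEq] at hA
      subst hA
      obtain ⟨a, ha, h⟩ := (rkey e he).2.2.2.2
      rw [h]; exact ⟨by simp [queueCTA], ha⟩
    · simp [queueCTA] at hA

theorem queueCTA_isStart (m n q : ℕ) (E : List Edge) :
    (queueCTA m n q E).IsStart [2 * q, 0] := by
  simp [CTA.IsStart, queueCTA, writer, reader]

/-! ### Soundness: the invariant of the handshake -/

/-- The content of the channel, from the head of the queue to its tail. -/
def Config.letters (γ : Config) : List ℕ :=
  ((γ.chan (0, 1)).map Prod.fst).reverse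

theorem Config.letters_elapse (γ : Config) (t : ℕ) : (γ.elapse t).letters = γ.letters := by
  simp [Config.letters, Config.elapse, Function.comp_def]

theorem Config.letters_move (γ : Config) (i : ℕ) (e : Edge) :
    (γ.move i e).letters = γ.letters := rfl

theorem Config.letters_setChan (γ : Config) (w : List (ℕ × ℕ)) :
    (γ.setChan (0, 1) w).letters = (w.map Prod.fst).reverse := by
  simp [Config.letters, Config.setChan]

/-- What holds for all reachable configurations of the simulation of a queue system in which the
configurations satisfying `R` are reachable. -/
def SimInv (m : ℕ) (R : ℕ × List ℕ → Prop) (γ : Config) : Prop :=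
  γ.loc 1 = 0 ∧ ∃ q,
    (γ.loc 0 = 2 * q ∧ R (q, γ.letters) ∧ ∀ a < m, γ.globVal a = 0 → γ.globVal m = 0) ∨
    (γ.loc 0 = 2 * q + 1 ∧ (γ.globVal m = 0 → R (q, γ.letters)) ∧
      (0 < γ.globVal m → ∀ a < m, γ.globVal a = 0 → ∀ w, γ.letters = a :: w → R (q, w)))

/-- After a positive delay no clock is 0, so every clause that assumes a clock at 0 holds vacuously,
while locations and letters are unchanged. -/
theorem SimInv.elapse {m : ℕ} {R : ℕ × List ℕ → Prop} {γ : Config} (h : SimInv m R γ) (t : ℕ) :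
    SimInv m R (γ.elapse t) := by
  rcases Nat.eq_zero_or_pos t with rfl | ht
  · have : γ.elapse 0 = γ := by
      cases γ
      simp [Config.elapse]
    rwa [this]
  · obtain ⟨h1, q, ⟨h2, h3, h4⟩ | ⟨h2, h3, h4⟩⟩ := h
    · refine ⟨h1, q, Or.inl ⟨h2, by rwa [Config.letters_elapse], ?_⟩⟩
      intro a _ h
      simp only [Config.elapse] at h
      omega
    · refine ⟨h1, q, Or.inr ⟨h2, ?_, ?_⟩⟩
      · intro h
        simp only [Config.elapse] at h
        omega
      · intro _ a _ h
        simp only [Config.elapse] at h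
        omega

/-- At even locations the reader is blocked, so only the writer acts. At odd locations the value of
clock `m` tells whether the awaited read has happened: if it is positive, a letter clock at 0 names
the letter still to be read. About `R` only closure under steps of the queue system is used. -/
theorem SimInv.step {m n q : ℕ} {E : List QueueEdge} {R : ℕ × List ℕ → Prop}
    (hE : Bounded m n E) (hR : ∀ c d, R c → QueueStep E c d → R d) {γ δ : Config} (hγ : SimInv m R γ)
    (h : (queueCTA m n q (E.flatMap (QueueEdge.edges m))).Step γ δ) : SimInv m R δ := by
  have henabled : ∀ i e, (queueCTA m n q (E.flatMap (QueueEdge.edges m))).Enabled γ i e →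
      γ.loc i = e.src ∧ γ.Sat i e.guard ∧
      ((i = 0 ∧ ∃ f ∈ E, e ∈ f.edges m) ∨ (i = 1 ∧ ∃ a < m, e = readEdge m a)) := by
    rintro i e ⟨⟨A, hA, he⟩, hl, hg⟩
    refine ⟨hl, hg, ?_⟩
    rcases i with _ | _ | i
    · simp only [queueCTA, List.getElem?_cons_zero, Option.some.injEq] at hA
      subst hA
      exact Or.inl ⟨rfl, List.mem_flatMap.1 he⟩
    · simp only [queueCTA, zero_add, List.getElem?_cons_succ, List.getElem?_cons_zero,
        Option.some.injEq] at hA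
      subst hA
      simp only [reader, List.mem_map, List.mem_range] at he
      obtain ⟨a, ha, rfl⟩ := he
      exact Or.inr ⟨rfl, a, ha, rfl⟩
    · simp [queueCTA] at hA
  obtain ⟨h1, p, hp⟩ := hγ
  cases h with
  | time t => exact SimInv.elapse ⟨h1, p, hp⟩ t
  | nop i e h hop =>
    obtain ⟨hl, hg, ⟨rfl, ⟨s, o, d⟩, hf, he⟩ | ⟨rfl, a, ha, rfl⟩⟩ := henabled i e h
    · cases o with
      | jump =>
        simp only [QueueEdge.edges, List.mem_singleton] at he
        subst he
        simp only at hl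
        rcases hp with ⟨h2, h3, h4⟩ | ⟨h2, h3, h4⟩
        · obtain rfl : s = p := by omega
          refine ⟨by simp [Config.move, h1], d, Or.inl ⟨by simp [Config.move], ?_, ?_⟩⟩
          · exact hR _ _ h3 ⟨_, hf, rfl, rfl, .jump _⟩
          · intro a ha _
            simp [Config.move, mem_allClocks]
        · omega
      | write a =>
        simp only [QueueEdge.edges, List.mem_singleton] at he
        subst he
        simp at hop
      | read a =>
        simp only [QueueEdge.edges, List.mem_cons, List.not_mem_nil, or_false] at he
        rcases he with rfl | rfl
        · simp only at hl
          have hg1 : 1 ≤ γ.globVal m := hg ⟨.glob m, .ge, 1⟩ (by simp)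
          rcases hp with ⟨h2, h3, h4⟩ | ⟨h2, h3, h4⟩
          · obtain rfl : s = p := by omega
            refine ⟨by simp [Config.move, h1], d, Or.inr ⟨by simp [Config.move], ?_, ?_⟩⟩
            · intro h0
              simp [Config.move, (hE _ hf : _ ∧ _ ∧ a < m).2.2.ne'] at h0
              omega
            · intro _ b hb h0 w hw
              rw [Config.letters_move] at hw
              rw [hw] at h3
              -- Clock `m` is positive, so by the even clause no letter clock was 0 before this
              -- transition. Hence only the clock of `a`, just reset, can be 0 now.
              by_cases hba : b = a
              · subst hba
                exact hR _ _ h3 ⟨_, hf, rfl, rfl, .read _ _⟩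
              · simp only [Config.move, List.mem_singleton, Clock.glob.injEq, hba, if_false] at h0
                have := h4 b hb h0
                omega
          · omega
        · simp only at hl
          have hg1 : γ.globVal m = 0 := hg ⟨.glob m, .eq, 0⟩ (by simp)
          rcases hp with ⟨h2, h3, h4⟩ | ⟨h2, h3, h4⟩
          · omega
          · obtain rfl : d = p := by omega
            refine ⟨by simp [Config.move, h1], d, Or.inl ⟨by simp [Config.move], h3 hg1, ?_⟩⟩
            intro a ha _
            simp [Config.move, mem_allClocks]
    · simp [readEdge] at hop
  | send i e j a h hop =>
    obtain ⟨hl, hg, ⟨rfl, ⟨s, o, d⟩, hf, he⟩ | ⟨rfl, a, ha, rfl⟩⟩ := henabled i e h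
    · cases o with
      | jump =>
        simp only [QueueEdge.edges, List.mem_singleton] at he
        subst he
        simp at hop
      | write b =>
        simp only [QueueEdge.edges, List.mem_singleton] at he
        subst he
        simp only at hl
        simp only [Op.send.injEq] at hop
        obtain ⟨rfl, rfl⟩ := hop
        rcases hp with ⟨h2, h3, h4⟩ | ⟨h2, h3, h4⟩
        · obtain rfl : s = p := by omega
          refine ⟨by simp [Config.move, Config.setChan, h1], d,
            Or.inl ⟨by simp [Config.move, Config.setChan], ?_, ?_⟩⟩
          · refine hR _ _ h3 ⟨_, hf, rfl, rfl, ?_⟩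
            rw [Config.letters_setChan]
            simp only [List.map_cons, List.reverse_cons]
            exact .write _ _
          · intro a ha _
            simp [Config.move, Config.setChan, mem_allClocks]
        · omega
      | read b =>
        simp only [QueueEdge.edges, List.mem_cons, List.not_mem_nil, or_false] at he
        rcases he with rfl | rfl <;> simp at hop
    · simp [readEdge] at hop
  | recv i e j a I w t h hop hw ht =>
    obtain ⟨hl, hg, ⟨rfl, ⟨s, o, d⟩, hf, he⟩ | ⟨rfl, b, hb, rfl⟩⟩ := henabled i e h
    · exfalso
      cases o with
      | jump | write b =>
        simp only [QueueEdge.edges, List.mem_singleton] at he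
        subst he
        simp at hop
      | read b =>
        simp only [QueueEdge.edges, List.mem_cons, List.not_mem_nil, or_false] at he
        rcases he with rfl | rfl <;> simp at hop
    · simp only [readEdge, Op.recv.injEq] at hop
      obtain ⟨rfl, rfl, rfl⟩ := hop
      have hgb : γ.globVal b = 0 := hg ⟨.glob b, .eq, 0⟩ (by simp [readEdge])
      have hgm : 1 ≤ γ.globVal m := hg ⟨.glob m, .ge, 1⟩ (by simp [readEdge])
      rcases hp with ⟨h2, h3, h4⟩ | ⟨h2, h3, h4⟩
      -- At an even location a letter clock at 0 forces clock `m` to be 0, against the guard of the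
      -- reader.
      · have := h4 b hb hgb
        omega
      -- The reset of clock `m` reports the read and at the same time disables a second one.
      · have hm : ((γ.move 1 (readEdge m b)).setChan (0, 1) w).globVal m = 0 := by
          simp [Config.move, Config.setChan, readEdge]
        refine ⟨by simp [Config.move, Config.setChan, readEdge], p,
          Or.inr ⟨by simp [Config.move, Config.setChan, h2], fun _ => ?_, fun h => ?_⟩⟩
        · refine h4 hgm b hb hgb _ ?_
          rw [Config.letters_setChan]
          simp [Config.letters, hw]
        · omega

theorem simInv_of_reaches {m n q : ℕ} {E : List QueueEdge} (hE : Bounded m n E) {γ : Config}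
    (h : (queueCTA m n q (E.flatMap (QueueEdge.edges m))).Reaches [2 * q, 0] γ) :
    SimInv m (QueueReaches E (q, [])) γ := by
  induction h with
  | refl => exact ⟨rfl, q, Or.inl ⟨rfl, .refl, fun _ _ _ => rfl⟩⟩
  | tail _ hs ih => exact ih.step hE (fun _ _ hc hs => hc.tail hs) hs

/-! ### Completeness: runs of the queue system lift to the automata -/

/-- A configuration that represents a configuration of a queue system. -/
structure Represents (m : ℕ) (γ : Config) (c : ℕ × List ℕ) : Prop where
  loc_zero : γ.loc 0 = 2 * c.1
  loc_one : γ.loc 1 = 0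
  glob : ∀ a ≤ m, γ.globVal a = 0
  letters : γ.letters = c.2

/-- A jump or a write is one transition that resets all clocks. A read is one time unit followed by
the three transitions of the handshake, the last of which again resets all clocks. -/
theorem Represents.step {m n q : ℕ} {E : List QueueEdge} (hE : Bounded m n E) {γ : Config}
    {c d : ℕ × List ℕ} (hγ : Represents m γ c) (h : QueueStep E c d) :
    ∃ δ, Relation.ReflTransGen (queueCTA m n q (E.flatMap (QueueEdge.edges m))).Step γ δ ∧
      Represents m δ d := by
  obtain ⟨c1, c2⟩ := c
  obtain ⟨d1, d2⟩ := d
  obtain ⟨⟨s, o, d⟩, he, hs, hd, hact⟩ := h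
  simp only at hs hd hact
  subst hs hd
  have hlet := (hE _ he).2.2
  have hen : ∀ γ : Config, ∀ f ∈ QueueEdge.edges m ⟨s, o, d⟩, γ.loc 0 = f.src → γ.Sat 0 f.guard →
      (queueCTA m n q (E.flatMap (QueueEdge.edges m))).Enabled γ 0 f := by
    intro γ f hf h1 h2
    exact ⟨⟨_, rfl, List.mem_flatMap.2 ⟨_, he, hf⟩⟩, h1, h2⟩
  obtain ⟨h0, h1, hg, hl⟩ := hγ
  simp only at h0 hl
  cases hact with
  | jump =>
    refine ⟨_, .single (.nop γ 0 _ (hen γ _ (List.mem_singleton.2 rfl) h0 (by simp [Config.Sat]))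
      rfl), ?_, ?_, ?_, hl⟩
    · simp [Config.move]
    · simpa [Config.move] using h1
    · intro a ha
      simp [Config.move, mem_allClocks, ha]
  | write a =>
    refine ⟨_, .single (.send γ 0 _ 1 a (hen γ _ (List.mem_singleton.2 rfl) h0
      (by simp [Config.Sat])) rfl), ?_, ?_, ?_, ?_⟩
    · simp [Config.move, Config.setChan]
    · simpa [Config.move, Config.setChan] using h1
    · intro a ha
      simp [Config.move, Config.setChan, mem_allClocks, ha]
    · rw [Config.letters_setChan, ← hl]
      simp [Config.letters]
  | read a =>
    have ha : a < m := hlet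
    -- `letters` reverses the channel, so the first letter of the queue is the last entry of the
    -- channel.
    obtain ⟨w, t, hw⟩ : ∃ w t, γ.chan (0, 1) = w ++ [(a, t)] := by
      rcases List.eq_nil_or_concat (γ.chan (0, 1)) with h | ⟨w, ⟨b, t⟩, h⟩
      · simp [Config.letters, h] at hl
      · refine ⟨w, t, ?_⟩
        simp [Config.letters, h] at hl
        rw [h, hl.1]
        simp
    -- All clocks are 0 at first. One time unit makes clock `m` positive, as the request and the
    -- read require; no more time passes before the answer is seen.
    let γ₁ := γ.elapse 1
    let e₁ : Edge := ⟨2 * s, [⟨.glob m, .ge, 1⟩], .nop, [.glob a], 2 * d + 1⟩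
    let γ₂ := γ₁.move 0 e₁
    let γ₃ := (γ₂.move 1 (readEdge m a)).setChan (0, 1) (w.map fun p => (p.1, p.2 + 1))
    let e₂ : Edge := ⟨2 * d + 1, [⟨.glob m, .eq, 0⟩], .nop, allClocks m, 2 * d⟩
    have s₁ : (queueCTA m n q (E.flatMap (QueueEdge.edges m))).Step γ γ₁ := .time γ 1
    have s₂ : (queueCTA m n q (E.flatMap (QueueEdge.edges m))).Step γ₁ γ₂ := by
      refine .nop γ₁ 0 e₁ (hen _ _ (by simp [QueueEdge.edges, e₁]) h0 ?_) rfl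
      simp [Config.Sat, e₁, γ₁, Config.clockVal, Config.elapse, Cmp.Holds]
    have s₃ : (queueCTA m n q (E.flatMap (QueueEdge.edges m))).Step γ₂ γ₃ := by
      refine .recv γ₂ 1 (readEdge m a) 0 a anyAge _ (t + 1) ⟨⟨reader m, rfl, ?_⟩, ?_, ?_⟩ rfl ?_
        (anyAge_mem _)
      · exact List.mem_map_of_mem (List.mem_range.2 ha)
      · simpa [γ₂, γ₁, readEdge, Config.move, Config.elapse] using h1
      · simp [Config.Sat, readEdge, γ₂, γ₁, e₁, Config.clockVal, Config.elapse, Config.move,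
          Cmp.Holds, ha.ne']
      · simp [γ₂, γ₁, Config.move, Config.elapse, hw]
    have s₄ : (queueCTA m n q (E.flatMap (QueueEdge.edges m))).Step γ₃ (γ₃.move 0 e₂) := by
      refine .nop γ₃ 0 e₂ (hen _ _ (by simp [QueueEdge.edges, e₂]) ?_ ?_) rfl
      · simp [γ₃, γ₂, e₁, e₂, Config.move, Config.setChan]
      · simp [Config.Sat, e₂, γ₃, Config.clockVal, Config.move, Config.setChan, Cmp.Holds,
          readEdge]
    refine ⟨_, (((Relation.ReflTransGen.single s₁).tail s₂).tail s₃).tail s₄, ?_, ?_, ?_, ?_⟩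
    · simp [Config.move, e₂]
    · simp [Config.move, Config.setChan, γ₃, readEdge]
    · intro b hb
      simp [Config.move, e₂, mem_allClocks, hb]
    · rw [Config.letters_move, Config.letters_setChan]
      simp [Config.letters, hw] at hl
      simpa [Function.comp_def] using hl

theorem exists_represents_of_queueReaches {m n q : ℕ} {E : List QueueEdge} (hE : Bounded m n E)
    {c : ℕ × List ℕ} (h : QueueReaches E (q, []) c) :
    ∃ γ, (queueCTA m n q (E.flatMap (QueueEdge.edges m))).Reaches [2 * q, 0] γ ∧
      Represents m γ c := by
  induction h with
  | refl => exact ⟨_, .refl, rfl, rfl, fun _ _ => rfl, rfl⟩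
  | tail _ hs ih =>
    obtain ⟨γ, hγ, hr⟩ := ih
    obtain ⟨δ, hδ, hr⟩ := hr.step hE hs
    exact ⟨δ, hγ.trans hδ, hr⟩

/-! ### Reachability in the automata versus the queue system -/

theorem exists_loc_iff {m n q f : ℕ} {E : List QueueEdge} (hE : Bounded m n E) :
    (∃ γ, (queueCTA m n q (E.flatMap (QueueEdge.edges m))).Reaches [2 * q, 0] γ ∧
      γ.loc 0 = 2 * f) ↔ ∃ w, QueueReaches E (q, []) (f, w) := by
  constructor
  · rintro ⟨γ, hγ, hf⟩
    obtain ⟨_, p, ⟨h2, h3, _⟩ | ⟨h2, _⟩⟩ := simInv_of_reaches hE hγ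
    · obtain rfl : p = f := by omega
      exact ⟨_, h3⟩
    · omega
  · rintro ⟨w, hw⟩
    obtain ⟨γ, hγ, hr⟩ := exists_represents_of_queueReaches hE hw
    exact ⟨γ, hγ, hr.loc_zero⟩

/-- The data of the configuration with the locations `2 * f` and `0`, in which all clocks are `0`
and the channel is empty. -/
def cleared (m f : ℕ) : ConfigData :=
  ⟨[2 * f, 0], [[], []], List.replicate (m + 1) 0, [[]]⟩

theorem data_queueCTA (m n q : ℕ) (E : List Edge) (γ : Config) :
    (queueCTA m n q E).data γ = ⟨[γ.loc 0, γ.loc 1], [[], []],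
      (List.range (m + 1)).map γ.globVal, [γ.chan (0, 1)]⟩ := by
  simp [CTA.data, queueCTA, writer, reader, List.range_succ]

theorem Represents.data_eq {m n q f : ℕ} {E : List Edge} {γ : Config}
    (h : Represents m γ (f, [])) : (queueCTA m n q E).data γ = cleared m f := by
  obtain ⟨h0, h1, hg, hl⟩ := h
  have hc : γ.chan (0, 1) = [] := by simpa [Config.letters] using hl
  rw [data_queueCTA, cleared, h0, h1, hc]
  congr 1
  rw [List.eq_replicate_iff]
  simp only [List.length_map, List.length_range, List.mem_map, List.mem_range, true_and]
  rintro b ⟨a, ha, rfl⟩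
  exact hg a (by omega)

/-- Forward, the invariant ignores clock values and needs only the even location and the empty
channel. Backward, `Represents` fixes all clocks at 0, so the configuration reached has exactly the
data `cleared m f`. -/
theorem exists_data_iff {m n q f : ℕ} {E : List QueueEdge} (hE : Bounded m n E) :
    (∃ γ, (queueCTA m n q (E.flatMap (QueueEdge.edges m))).Reaches [2 * q, 0] γ ∧
      (queueCTA m n q (E.flatMap (QueueEdge.edges m))).data γ = cleared m f) ↔
      QueueReaches E (q, []) (f, []) := by
  constructor
  · rintro ⟨γ, hγ, hf⟩
    rw [data_queueCTA, cleared] at hf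
    simp only [ConfigData.mk.injEq, List.cons.injEq, and_true, true_and] at hf
    obtain ⟨⟨hf, _⟩, _, hc⟩ := hf
    obtain ⟨_, p, ⟨h2, h3, _⟩ | ⟨h2, _⟩⟩ := simInv_of_reaches hE hγ
    · obtain rfl : p = f := by omega
      simpa [Config.letters, hc] using h3
    · omega
  · intro hw
    obtain ⟨γ, hγ, hr⟩ := exists_represents_of_queueReaches hE hw
    exact ⟨γ, hγ, hr.data_eq⟩

theorem exists_isConfig_cleared {m n q f : ℕ} (E : List Edge) (hf : f < n) :
    ∃ γ, (queueCTA m n q E).IsConfig γ ∧ (queueCTA m n q E).data γ = cleared m f := by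
  have hr : Represents m (initial [2 * f, 0]) (f, []) := ⟨rfl, rfl, fun _ _ => rfl, rfl⟩
  refine ⟨_, ⟨?_, ?_, ?_⟩, hr.data_eq⟩
  · intro i A hA
    rcases i with _ | _ | i
    · simp only [queueCTA, List.getElem?_cons_zero, Option.some.injEq] at hA
      subst hA
      simp [initial, writer, hf]
    · simp only [queueCTA, zero_add, List.getElem?_cons_succ, List.getElem?_cons_zero,
        Option.some.injEq] at hA
      subst hA
      simp [initial, reader]
    · simp [queueCTA] at hA
  · simp [initial]
  · simp [initial]

open Turing StateTransition Relation

/-! ### Deterministic queue machines -/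

/-- The instructions of a queue machine with the states `Q` and the letters `A`. -/
inductive QueueInstr (Q A : Type*) where
  | jump (q : Q)
  | write (a : A) (q : Q)
  | read (f : A → Q)

/-- The step function of the queue machine `M`. -/
def queueStep {Q A : Type*} (M : Q → QueueInstr Q A) (c : Q × List A) : Option (Q × List A) :=
  match M c.1, c.2 with
  | .jump q, w => some (q, w)
  | .write a q, w => some (q, w ++ [a])
  | .read f, a :: w => some (f a, w)
  | .read _, [] => none

/-- The instruction only leads to states in `S`. -/
def QueueInstr.SuccIn {Q A : Type*} (S : Set Q) : QueueInstr Q A → Prop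
  | .jump q => q ∈ S
  | .write _ q => q ∈ S
  | .read f => ∀ a, f a ∈ S

theorem queueStep_mem {Q A : Type*} {M : Q → QueueInstr Q A} {S : Set Q}
    (hS : ∀ q ∈ S, (M q).SuccIn S) {c d : Q × List A} (hc : c.1 ∈ S) (h : d ∈ queueStep M c) :
    d.1 ∈ S := by
  have := hS _ hc
  obtain ⟨q, w⟩ := c
  simp only at this
  cases hM : M q with
  | jump p =>
    simp only [queueStep, hM, Option.mem_def, Option.some.injEq] at h
    rw [hM] at this
    subst h
    exact this
  | write a p =>
    simp only [queueStep, hM, Option.mem_def, Option.some.injEq] at h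
    rw [hM] at this
    subst h
    exact this
  | read f =>
    rw [hM] at this
    cases w with
    | nil => simp [queueStep, hM] at h
    | cons a w =>
      simp only [queueStep, hM, Option.mem_def, Option.some.injEq] at h
      subst h
      exact this a

/-! ### Simulation of stack machines by queue machines

A queue with letters in `K × G` represents stacks indexed by `K` with entries in `G`: stack `k`
consists of the letters with first component `k`. The additional letter `none` marks the end of
the queue while the queue is being rotated. -/

section Simulation

variable {K G Λ σ : Type*}

/-- What the queue machine is doing. -/
inductive Phase (K G : Type*) where
  | run
  | insert
  | scan
  | scanBack (b : K × G)
  | rotate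
  | rotateBack (b : K × G)

/-- The states of the queue machine; `none` is the halting state. -/
abbrev SimState (K G Λ σ : Type*) : Type _ :=
  Option (Phase K G × TM2.Stmt (fun _ : K => G) Λ σ × σ)

instance [Finite K] [Finite G] : Finite (Phase K G) := by
  let f : Phase K G → Fin 4 × Option (K × G) := fun
    | .run => (0, none)
    | .insert => (1, none)
    | .scan => (2, none)
    | .scanBack b => (2, some b)
    | .rotate => (3, none)
    | .rotateBack b => (3, some b)
  refine Finite.of_injective f ?_
  intro a b h
  cases a <;> cases b <;> simp [f] at h <;> simp [h]

/-- The states of the queue machine that are needed for labels in `S`. -/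
def simSupport (tr : Λ → TM2.Stmt (fun _ : K => G) Λ σ)
    (S : Finset Λ) : Set (SimState K G Λ σ) :=
  {s | ∀ p ∈ s, some p.2.1 ∈ TM2.stmts tr S}

theorem simSupport_finite [Finite K] [Finite G] [Finite σ] (tr : Λ → TM2.Stmt (fun _ : K => G) Λ σ)
    (S : Finset Λ) :
    (simSupport tr S).Finite := by
  have : {q | some q ∈ TM2.stmts tr S}.Finite :=
    (TM2.stmts tr S).finite_toSet.preimage (Option.some_injective _).injOn
  have h := ((Set.finite_univ (α := Phase K G)).prod (this.prod (Set.finite_univ (α := σ))))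
  refine ((h.image some).insert none).subset ?_
  rintro (_ | p) hp
  · exact Set.mem_insert _ _
  · exact Set.mem_insert_of_mem _ ⟨p, ⟨trivial, hp p rfl, trivial⟩, rfl⟩

variable [DecidableEq K]

/-- The queue machine that simulates the stack machine `tr`. -/
def simulator (tr : Λ → TM2.Stmt (fun _ : K => G) Λ σ) :
    SimState K G Λ σ → QueueInstr (SimState K G Λ σ) (Option (K × G))
  | none => .read fun _ => none
  | some (.run, .push k f q, v) => .write none (some (.insert, .push k f q, v))
  | some (.run, .peek k f q, v) => .write none (some (.scan, .peek k f q, v))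
  | some (.run, .pop k f q, v) => .write none (some (.scan, .pop k f q, v))
  | some (.run, .load f q, v) => .jump (some (.run, q, f v))
  | some (.run, .branch f q₁ q₂, v) => .jump (some (.run, cond (f v) q₁ q₂, v))
  | some (.run, .goto f, v) => .jump (some (.run, tr (f v), v))
  | some (.run, .halt, _) => .jump none
  | some (.insert, .push k f q, v) => .write (some (k, f v)) (some (.rotate, q, v))
  | some (.scan, .peek k f q, v) => .read fun
    | none => some (.run, q, f v none)
    | some b => if b.1 = k then some (.rotateBack b, q, f v (some b.2))
      else some (.scanBack b, .peek k f q, v)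
  | some (.scan, .pop k f q, v) => .read fun
    | none => some (.run, q, f v none)
    | some b => if b.1 = k then some (.rotate, q, f v (some b.2))
      else some (.scanBack b, .pop k f q, v)
  | some (.scanBack b, q, v) => .write (some b) (some (.scan, q, v))
  | some (.rotate, q, v) => .read fun
    | none => some (.run, q, v)
    | some b => some (.rotateBack b, q, v)
  | some (.rotateBack b, q, v) => .write (some b) (some (.rotate, q, v))
  -- These combinations are never entered from a `run` state; the value only has to stay inside the
  -- support.
  | some (.insert, _, _) => .jump none
  | some (.scan, _, _) => .jump none

/-- Stack `k` of the stacks that are represented by the list `u`. -/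
def stackOf (k : K) (u : List (K × G)) : List G :=
  u.filterMap fun b => if b.1 = k then some b.2 else none

/-- The content of the queue without a marker. -/
def marked (u : List (K × G)) : List (Option (K × G)) := u.map some

theorem stackOf_nil (k : K) : stackOf k ([] : List (K × G)) = [] := rfl

theorem stackOf_cons (k : K) (b : K × G) (u : List (K × G)) :
    stackOf k (b :: u) = if b.1 = k then b.2 :: stackOf k u else stackOf k u := by
  unfold stackOf
  rw [List.filterMap_cons]
  split_ifs <;> rfl

/-! ### Runs of the simulating queue machine -/

variable (tr : Λ → TM2.Stmt (fun _ : K => G) Λ σ)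

/-- Here `z` is what already stands behind the marker. Letters of `u` move there one by one, and
reading the marker ends the round. -/
theorem reaches_rotate (q : TM2.Stmt (fun _ : K => G) Λ σ) (v : σ) (u z : List (K × G)) :
    Reaches (queueStep (simulator tr)) (some (.rotate, q, v), marked u ++ none :: marked z)
      (some (.run, q, v), marked (z ++ u)) := by
  induction u generalizing z with
  | nil => exact .single (by simp [queueStep, simulator, marked])
  | cons b u ih =>
    refine .head (b := (some (.rotateBack b, q, v), marked u ++ none :: marked z))
      (by simp [queueStep, simulator, marked]) ?_
    refine .head (b := (some (.rotate, q, v), marked u ++ none :: marked (z ++ [b])))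
      (by simp [queueStep, simulator, marked]) ?_
    have := ih (z ++ [b])
    rwa [List.append_assoc] at this

/-- Letters of other stacks are moved behind the marker until the first one tagged `k` appears. That
one is the top of stack `k`; it is written back as well, and the round is completed by rotation. -/
theorem reaches_peek (k : K) (f : σ → Option G → σ) (q : TM2.Stmt (fun _ : K => G) Λ σ) (v : σ)
    (u z : List (K × G)) :
    Reaches (queueStep (simulator tr)) (some (.scan, .peek k f q, v), marked u ++ none :: marked z)
      (some (.run, q, f v (stackOf k u).head?), marked (z ++ u)) := by
  induction u generalizing z with
  | nil => exact .single (by simp [queueStep, simulator, marked, stackOf_nil])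
  | cons b u ih =>
    by_cases hb : b.1 = k
    · refine .head (b := (some (.rotateBack b, q, f v (some b.2)), marked u ++ none :: marked z))
        (by simp [queueStep, simulator, marked, hb]) ?_
      refine .head (b := (some (.rotate, q, f v (some b.2)),
        marked u ++ none :: marked (z ++ [b]))) (by simp [queueStep, simulator, marked]) ?_
      have := reaches_rotate tr q (f v (some b.2)) u (z ++ [b])
      rw [List.append_assoc] at this
      simpa [stackOf_cons, hb, Reaches] using this
    · refine .head (b := (some (.scanBack b, .peek k f q, v), marked u ++ none :: marked z))
        (by simp [queueStep, simulator, marked, hb]) ?_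
      refine .head (b := (some (.scan, .peek k f q, v),
        marked u ++ none :: marked (z ++ [b]))) (by simp [queueStep, simulator, marked]) ?_
      have := ih (z ++ [b])
      rw [List.append_assoc] at this
      simpa [stackOf_cons, hb, Reaches] using this

/-- As for `peek`, except that the first letter tagged `k` is not written back. -/
theorem reaches_pop (k : K) (f : σ → Option G → σ) (q : TM2.Stmt (fun _ : K => G) Λ σ) (v : σ)
    (u z : List (K × G)) :
    Reaches (queueStep (simulator tr)) (some (.scan, .pop k f q, v), marked u ++ none :: marked z)
      (some (.run, q, f v (stackOf k u).head?), marked (z ++ u.eraseP fun b => b.1 = k)) := by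
  induction u generalizing z with
  | nil => exact .single (by simp [queueStep, simulator, marked, stackOf_nil])
  | cons b u ih =>
    by_cases hb : b.1 = k
    · refine .head (b := (some (.rotate, q, f v (some b.2)), marked u ++ none :: marked z))
        (by simp [queueStep, simulator, marked, hb]) ?_
      have := reaches_rotate tr q (f v (some b.2)) u z
      simpa [stackOf_cons, hb, Reaches] using this
    · refine .head (b := (some (.scanBack b, .pop k f q, v), marked u ++ none :: marked z))
        (by simp [queueStep, simulator, marked, hb]) ?_
      refine .head (b := (some (.scan, .pop k f q, v),
        marked u ++ none :: marked (z ++ [b]))) (by simp [queueStep, simulator, marked]) ?_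
      have := ih (z ++ [b])
      rw [List.append_assoc] at this
      simpa [stackOf_cons, hb, Reaches] using this

theorem stackOf_eraseP (k j : K) (u : List (K × G)) :
    stackOf j (u.eraseP fun b => b.1 = k) =
      if j = k then (stackOf k u).tail else stackOf j u := by
  induction u with
  | nil => simp [stackOf_nil]
  | cons b u ih =>
    by_cases hb : b.1 = k
    · by_cases hj : j = k
      · subst hj
        simp [stackOf_cons, hb]
      · have : b.1 ≠ j := fun h => hj (h.symm.trans hb)
        simp [stackOf_cons, hb, hj, Ne.symm hj]
    · by_cases hj : j = k
      · subst hj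
        simpa [stackOf_cons, hb] using ih
      · simp only [hj, if_false] at ih
        simp [stackOf_cons, hb, hj, ih]

/-- The halting state drains the queue, which makes the final queue content predictable;
configuration reachability depends on this. -/
theorem reaches_nil (w : List (Option (K × G))) :
    Reaches (queueStep (simulator tr)) (none, w) (none, []) := by
  induction w with
  | nil => exact .refl
  | cons a w ih => exact .head (b := (none, w)) (by simp [queueStep, simulator]) ih

/-- A configuration of the stack machine is represented by a configuration of the queue
machine. -/
def SimRel (c : TM2.Cfg (fun _ : K => G) Λ σ)
    (d : SimState K G Λ σ × List (Option (K × G))) : Prop :=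
  match c.l with
  | none => d = (none, [])
  | some l => d.1 = some (.run, tr l, c.var) ∧
      ∃ u, d.2 = marked u ∧ ∀ k, stackOf k u = c.stk k

/-- A step of the stack machine executes a whole statement up to `goto` or `halt`, hence the
induction on the statement. Each stack operation costs one round of the queue, started by writing
the marker. -/
theorem simulator_run (q : TM2.Stmt (fun _ : K => G) Λ σ) (v : σ) (u : List (K × G))
    (S : K → List G) (hS : ∀ k, stackOf k u = S k) :
    ∃ d, SimRel tr (TM2.stepAux q v S) d ∧
      Reaches₁ (queueStep (simulator tr)) (some (.run, q, v), marked u) d := by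
  induction q generalizing v u S with
  | push k f q ih =>
    obtain ⟨d, hd, hr⟩ := ih v ((k, f v) :: u) (Function.update S k (f v :: S k)) (by
      intro j
      by_cases hj : j = k
      · subst hj
        simp [stackOf_cons, hS]
      · simp [stackOf_cons, hS, hj, Ne.symm hj])
    refine ⟨d, hd, .head (b := (some (.insert, .push k f q, v), marked u ++ none :: marked []))
      (by simp [queueStep, simulator, marked]) ?_⟩
    -- The new letter is written behind the marker, so it comes first once `u` has been rotated: it
    -- is the new top of stack `k`.
    refine .head (b := (some (.rotate, q, v), marked u ++ none :: marked [(k, f v)]))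
      (by simp [queueStep, simulator, marked]) ?_
    exact TransGen.trans_right (reaches_rotate tr q v u [(k, f v)]) hr
  | peek k f q ih =>
    obtain ⟨d, hd, hr⟩ := ih (f v (S k).head?) u S hS
    refine ⟨d, hd, .head (b := (some (.scan, .peek k f q, v), marked u ++ none :: marked []))
      (by simp [queueStep, simulator, marked]) ?_⟩
    have := reaches_peek tr k f q v u []
    rw [hS] at this
    exact TransGen.trans_right this hr
  | pop k f q ih =>
    obtain ⟨d, hd, hr⟩ := ih (f v (S k).head?) (u.eraseP fun b => b.1 = k)
      (Function.update S k (S k).tail) (by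
        intro j
        rw [stackOf_eraseP]
        by_cases hj : j = k
        · subst hj
          simp [hS]
        · simp [hS, hj])
    refine ⟨d, hd, .head (b := (some (.scan, .pop k f q, v), marked u ++ none :: marked []))
      (by simp [queueStep, simulator, marked]) ?_⟩
    have := reaches_pop tr k f q v u []
    rw [hS] at this
    exact TransGen.trans_right this hr
  | load f q ih =>
    obtain ⟨d, hd, hr⟩ := ih (f v) u S hS
    exact ⟨d, hd, .head (by simp [queueStep, simulator]) hr⟩
  | branch f q₁ q₂ ih₁ ih₂ =>
    cases hf : f v
    · obtain ⟨d, hd, hr⟩ := ih₂ v u S hS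
      exact ⟨d, by simpa [hf] using hd, .head (by simp [queueStep, simulator, hf]) hr⟩
    · obtain ⟨d, hd, hr⟩ := ih₁ v u S hS
      exact ⟨d, by simpa [hf] using hd, .head (by simp [queueStep, simulator, hf]) hr⟩
  | goto f =>
    exact ⟨(some (.run, tr (f v), v), marked u), ⟨rfl, u, rfl, hS⟩,
      .single (by simp [queueStep, simulator])⟩
  | halt =>
    exact ⟨(none, []), rfl, .head' (b := (none, marked u)) (by simp [queueStep, simulator])
      (reaches_nil tr _)⟩

theorem simulator_respects :
    Respects (TM2.step tr) (queueStep (simulator tr)) (SimRel tr) := by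
  rintro ⟨l, v, S⟩ ⟨q, w⟩ h
  cases l with
  | none =>
    cases h
    rfl
  | some l =>
    obtain ⟨h1, u, h2, h3⟩ := h
    simp only at h1 h2 h3
    subst h1 h2
    exact simulator_run tr _ v u S h3

/-- A halted stack machine is represented only by the halting state with empty queue, where no read
is possible and the queue machine stops too. So termination transfers in both directions, and
draining removes the dependence on the remaining word. -/
theorem exists_reaches_none_iff {c : TM2.Cfg (fun _ : K => G) Λ σ}
    {d : SimState K G Λ σ × List (Option (K × G))} (h : SimRel tr c d) :
    ((∃ w, Reaches (queueStep (simulator tr)) d (none, w)) ↔ (eval (TM2.step tr) c).Dom) ∧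
      (Reaches (queueStep (simulator tr)) d (none, []) ↔ (eval (TM2.step tr) c).Dom) := by
  have h1 : (∃ w, Reaches (queueStep (simulator tr)) d (none, w)) →
      Reaches (queueStep (simulator tr)) d (none, []) :=
    fun ⟨w, hw⟩ => hw.trans (reaches_nil tr w)
  have h2 : Reaches (queueStep (simulator tr)) d (none, []) ↔ (eval (TM2.step tr) c).Dom := by
    constructor
    · intro hd
      rw [← tr_eval_dom (simulator_respects tr) h]
      exact Part.dom_iff_mem.2 ⟨_, mem_eval.2 ⟨hd, rfl⟩⟩
    · intro hd
      obtain ⟨b, hb⟩ := Part.dom_iff_mem.1 hd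
      obtain ⟨e, he, hm⟩ := tr_eval (simulator_respects tr) h hb
      have hl : b.l = none := by
        have := (mem_eval.1 hb).2
        obtain ⟨_ | l, v, S⟩ := b
        · rfl
        · simp at this
      rw [SimRel, hl] at he
      subst he
      exact (mem_eval.1 hm).1
  exact ⟨⟨fun h => h2.1 (h1 h), fun h => ⟨_, h2.2 h⟩⟩, h2⟩

/-- Each instruction keeps the statement, passes to a substatement, goes to the statement of a label
in `S`, or halts. With `simSupport_finite` this leaves finitely many states. -/
theorem simulator_succIn [Inhabited Λ] {S : Finset Λ} (hS : TM2.Supports tr S) :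
    ∀ s ∈ simSupport tr S, (simulator tr s).SuccIn (simSupport tr S) := by
  classical
  rintro (_ | ⟨ph, q, v⟩) hmem
  · simp [simulator, QueueInstr.SuccIn, simSupport]
  have hs : some q ∈ TM2.stmts tr S := hmem _ rfl
  clear hmem
  have mk : ∀ ph q v, some q ∈ TM2.stmts tr S → (some (ph, q, v) : SimState K G Λ σ) ∈
      simSupport tr S := by
    rintro ph q v h p ⟨⟩
    exact h
  have mn : (none : SimState K G Λ σ) ∈ simSupport tr S := by simp [simSupport]
  have hsup := TM2.stmts_supportsStmt hS hs
  cases q with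
  | push k f q =>
    have hq : some q ∈ TM2.stmts tr S :=
      TM2.stmts_trans (by simp [TM2.stmts₁, TM2.stmts₁_self]) hs
    cases ph <;> simp only [simulator, QueueInstr.SuccIn] <;>
      first | exact mk _ _ _ hs | exact mk _ _ _ hq | exact mn | skip
    rintro (_ | b) <;> exact mk _ _ _ hs
  | peek k f q =>
    have hq : some q ∈ TM2.stmts tr S :=
      TM2.stmts_trans (by simp [TM2.stmts₁, TM2.stmts₁_self]) hs
    cases ph <;> simp only [simulator, QueueInstr.SuccIn] <;>
      first | exact mk _ _ _ hs | exact mn | skip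
    · rintro (_ | b)
      · exact mk _ _ _ hq
      · simp only
        split_ifs
        · exact mk _ _ _ hq
        · exact mk _ _ _ hs
    · rintro (_ | b) <;> exact mk _ _ _ hs
  | pop k f q =>
    have hq : some q ∈ TM2.stmts tr S :=
      TM2.stmts_trans (by simp [TM2.stmts₁, TM2.stmts₁_self]) hs
    cases ph <;> simp only [simulator, QueueInstr.SuccIn] <;>
      first | exact mk _ _ _ hs | exact mn | skip
    · rintro (_ | b)
      · exact mk _ _ _ hq
      · simp only
        split_ifs
        · exact mk _ _ _ hq
        · exact mk _ _ _ hs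
    · rintro (_ | b) <;> exact mk _ _ _ hs
  | load f q =>
    have hq : some q ∈ TM2.stmts tr S :=
      TM2.stmts_trans (by simp [TM2.stmts₁, TM2.stmts₁_self]) hs
    cases ph <;> simp only [simulator, QueueInstr.SuccIn] <;>
      first | exact mk _ _ _ hs | exact mk _ _ _ hq | exact mn | skip
    rintro (_ | b) <;> exact mk _ _ _ hs
  | branch f q₁ q₂ =>
    have hq₁ : some q₁ ∈ TM2.stmts tr S :=
      TM2.stmts_trans (by simp [TM2.stmts₁, TM2.stmts₁_self]) hs
    have hq₂ : some q₂ ∈ TM2.stmts tr S :=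
      TM2.stmts_trans (by simp [TM2.stmts₁, TM2.stmts₁_self]) hs
    cases ph <;> simp only [simulator, QueueInstr.SuccIn] <;>
      first | exact mk _ _ _ hs | exact mn | skip
    · cases f v
      · exact mk _ _ _ hq₂
      · exact mk _ _ _ hq₁
    · rintro (_ | b) <;> exact mk _ _ _ hs
  | goto f =>
    have hq : some (tr (f v)) ∈ TM2.stmts tr S := by
      simp only [TM2.stmts, Finset.some_mem_insertNone, Finset.mem_biUnion]
      exact ⟨f v, hsup v, TM2.stmts₁_self⟩
    cases ph <;> simp only [simulator, QueueInstr.SuccIn] <;>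
      first | exact mk _ _ _ hs | exact mk _ _ _ hq | exact mn | skip
    rintro (_ | b) <;> exact mk _ _ _ hs
  | halt =>
    cases ph <;> simp only [simulator, QueueInstr.SuccIn] <;>
      first | exact mk _ _ _ hs | exact mn | skip
    rintro (_ | b) <;> exact mk _ _ _ hs

end Simulation

/-! ### Queue machines as queue systems -/

section Encoding

variable {Q A : Type*} [Fintype A] (num : Q → ℕ) (code : A → ℕ)

/-- The transitions that correspond to the instruction of state `q`. -/
noncomputable def QueueInstr.queueEdges (q : Q) : QueueInstr Q A → List QueueEdge
  | .jump p => [⟨num q, .jump, num p⟩]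
  | .write a p => [⟨num q, .write (code a), num p⟩]
  | .read f => Finset.univ.toList.map fun a => ⟨num q, .read (code a), num (f a)⟩

/-- The transitions that correspond to the instructions of the states in `S`. -/
noncomputable def machineEdges (M : Q → QueueInstr Q A) (S : Finset Q) : List QueueEdge :=
  S.toList.flatMap fun q => (M q).queueEdges num code q

variable {num code} {M : Q → QueueInstr Q A} {S : Finset Q}

theorem queueStep_machineEdges {E : List QueueEdge} (hE : machineEdges num code M S ⊆ E)
    {c d : Q × List A} (hc : c.1 ∈ S) (h : d ∈ queueStep M c) :
    QueueStep E (num c.1, c.2.map code) (num d.1, d.2.map code) := by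
  obtain ⟨q, w⟩ := c
  have hmem : ∀ e ∈ (M q).queueEdges num code q, e ∈ E :=
    fun e he => hE (List.mem_flatMap.2 ⟨q, Finset.mem_toList.2 hc, he⟩)
  cases hM : M q with
  | jump p =>
    simp only [queueStep, hM, Option.mem_def, Option.some.injEq] at h
    subst h
    exact ⟨_, hmem _ (by rw [hM]; exact List.mem_singleton.2 rfl), rfl, rfl, .jump _⟩
  | write a p =>
    simp only [queueStep, hM, Option.mem_def, Option.some.injEq] at h
    subst h
    refine ⟨_, hmem _ (by rw [hM]; exact List.mem_singleton.2 rfl), rfl, rfl, ?_⟩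
    simp only [List.map_append, List.map_cons, List.map_nil]
    exact .write _ _
  | read f =>
    cases w with
    | nil => simp [queueStep, hM] at h
    | cons a w =>
      simp only [queueStep, hM, Option.mem_def, Option.some.injEq] at h
      subst h
      exact ⟨⟨num q, .read (code a), num (f a)⟩,
        hmem _ (by rw [hM]; exact List.mem_map.2 ⟨a, by simp, rfl⟩), rfl, rfl, .read _ _⟩

/-- Injectivity of `num` on `S` shows that the transition stems from the instruction of `q`;
injectivity of `code` shows that a read consumed the letter actually at the head. -/
theorem exists_queueStep_of_machineEdges (hcode : Function.Injective code)
    (hnum : Set.InjOn num S) {q : Q} {u : List A} (hq : q ∈ S) {e : QueueEdge}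
    (he : e ∈ machineEdges num code M S) {d : ℕ × List ℕ} (hsrc : e.src = num q)
    (hdst : e.dst = d.1) (hact : e.op.Act (u.map code) d.2) :
    ∃ c ∈ queueStep M (q, u), d = (num c.1, c.2.map code) := by
  obtain ⟨d₁, d₂⟩ := d
  simp only at hdst hact
  subst hdst
  obtain ⟨p, hp, he⟩ := List.mem_flatMap.1 he
  have hps : e.src = num p := by
    cases hM : M p <;> rw [hM] at he <;> simp [QueueInstr.queueEdges] at he
    · rw [he]
    · rw [he]
    · obtain ⟨_, rfl⟩ := he
      rfl
  obtain rfl : p = q := hnum (Finset.mem_toList.1 hp) hq (hps.symm.trans hsrc)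
  cases hM : M p with
  | jump r =>
    rw [hM] at he
    simp only [QueueInstr.queueEdges, List.mem_singleton] at he
    subst he
    cases hact
    exact ⟨(r, u), by simp [queueStep, hM], rfl⟩
  | write a r =>
    rw [hM] at he
    simp only [QueueInstr.queueEdges, List.mem_singleton] at he
    subst he
    cases hact
    exact ⟨(r, u ++ [a]), by simp [queueStep, hM], by simp⟩
  | read f =>
    rw [hM] at he
    simp only [QueueInstr.queueEdges, List.mem_map, Finset.mem_toList, Finset.mem_univ,
      true_and] at he
    obtain ⟨a, rfl⟩ := he
    cases u with
    | nil => simp only [List.map_nil] at hact; cases hact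
    | cons b u =>
      simp only [List.map_cons] at hact
      generalize hb : code b = b' at hact
      cases hact
      obtain rfl := hcode hb
      exact ⟨(f b, u), by simp [queueStep, hM], rfl⟩

theorem bounded_machineEdges {m n : ℕ} (hcode : ∀ a, code a < m) (hnum : ∀ q ∈ S, num q < n)
    (hS : ∀ q ∈ S, (M q).SuccIn (S : Set Q)) : Bounded m n (machineEdges num code M S) := by
  intro e he
  obtain ⟨q, hq, he⟩ := List.mem_flatMap.1 he
  rw [Finset.mem_toList] at hq
  have hsucc := hS q hq
  cases hM : M q with
  | jump r =>
    rw [hM] at he hsucc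
    simp only [QueueInstr.queueEdges, List.mem_singleton] at he
    subst he
    exact ⟨hnum _ hq, hnum _ hsucc, trivial⟩
  | write a r =>
    rw [hM] at he hsucc
    simp only [QueueInstr.queueEdges, List.mem_singleton] at he
    subst he
    exact ⟨hnum _ hq, hnum _ hsucc, hcode a⟩
  | read f =>
    rw [hM] at he hsucc
    simp only [QueueInstr.queueEdges, List.mem_map, Finset.mem_toList, Finset.mem_univ,
      true_and] at he
    obtain ⟨a, rfl⟩ := he
    exact ⟨hnum _ hq, hnum _ (hsucc a), hcode a⟩

end Encoding

/-! ### Writing the input -/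

/-- The letters of `w`, each with the number of letters that follow it. -/
def withDistance (w : List ℕ) : List (ℕ × ℕ) :=
  w.foldr (fun a l => (l.length, a) :: l) []

/-- Transitions from state `s + w.length` to state `s` that write `w`. -/
def inputEdges (s : ℕ) (w : List ℕ) : List QueueEdge :=
  (withDistance w).map fun p => ⟨s + p.1 + 1, .write p.2, s + p.1⟩

theorem withDistance_cons (a : ℕ) (w : List ℕ) :
    withDistance (a :: w) = ((withDistance w).length, a) :: withDistance w := rfl

theorem length_withDistance (w : List ℕ) : (withDistance w).length = w.length := by
  induction w with
  | nil => rfl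
  | cons a w ih => simp [withDistance_cons, ih]

theorem mem_withDistance_iff {w : List ℕ} {p : ℕ × ℕ} :
    p ∈ withDistance w ↔ ∃ u v, w = u ++ p.2 :: v ∧ v.length = p.1 := by
  induction w with
  | nil => simp [withDistance]
  | cons a w ih =>
    rw [withDistance_cons, length_withDistance, List.mem_cons, ih]
    constructor
    · rintro (rfl | ⟨u, v, rfl, h⟩)
      · exact ⟨[], w, rfl, rfl⟩
      · exact ⟨a :: u, v, rfl, h⟩
    · rintro ⟨_ | ⟨b, u⟩, v, h, hv⟩
      · simp only [List.nil_append, List.cons.injEq] at h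
        obtain ⟨rfl, rfl⟩ := h
        exact Or.inl (by rw [hv])
      · simp only [List.cons_append, List.cons.injEq] at h
        exact Or.inr ⟨u, v, h.2, hv⟩

theorem mem_inputEdges_iff {s : ℕ} {w : List ℕ} {e : QueueEdge} :
    e ∈ inputEdges s w ↔ ∃ u a v, w = u ++ a :: v ∧
      e = ⟨s + v.length + 1, .write a, s + v.length⟩ := by
  simp only [inputEdges, List.mem_map, mem_withDistance_iff]
  constructor
  · rintro ⟨⟨i, a⟩, ⟨u, v, h, rfl⟩, rfl⟩
    exact ⟨u, a, v, h, rfl⟩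
  · rintro ⟨u, a, v, h, rfl⟩
    exact ⟨(v.length, a), ⟨u, v, h, rfl⟩, rfl⟩

/-- The state counts the letters still to be written: with `u` in the queue and `v` to come it is `s
+ v.length`. -/
theorem queueReaches_inputEdges {s : ℕ} {w : List ℕ} {E : List QueueEdge}
    (hE : inputEdges s w ⊆ E) (u v : List ℕ) (h : w = u ++ v) :
    QueueReaches E (s + v.length, u) (s, w) := by
  induction v generalizing u with
  | nil => simpa [h] using ReflTransGen.refl
  | cons a v ih =>
    exact .head ⟨_, hE (mem_inputEdges_iff.2 ⟨u, a, v, h, rfl⟩), by simp; omega, rfl, .write a u⟩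
      (ih (u ++ [a]) (by simp [h]))

/-- A queue machine with finitely many states can be turned into a queue system. -/
theorem exists_queueSystem {Q A : Type*} [Finite A] (M : Q → QueueInstr Q A) {S : Set Q}
    (hfin : S.Finite) (hS : ∀ q ∈ S, (M q).SuccIn S) {q₀ f : Q} (hq₀ : q₀ ∈ S) (hf : f ∈ S) :
    ∃ (m s t : ℕ) (F : List QueueEdge) (code : A → ℕ), t < s ∧ ∀ word : List A,
      Bounded m (s + word.length + 1) (F ++ inputEdges s (word.map code)) ∧
      ∀ w, QueueReaches (F ++ inputEdges s (word.map code)) (s + word.length, []) (t, w) ↔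
        ∃ u, w = u.map code ∧ Reaches (queueStep M) (q₀, word) (f, u) := by
  classical
  obtain ⟨_⟩ := nonempty_fintype A
  obtain ⟨S, rfl⟩ := hfin.exists_finset_coe
  simp only [Finset.mem_coe] at hS hq₀ hf
  let num : Q → ℕ := fun q => S.toList.idxOf q
  let code : A → ℕ := fun a => (Fintype.equivFin A a).val
  have hcode : Function.Injective code := Fin.val_injective.comp (Equiv.injective _)
  have hcode' : ∀ a, code a < Fintype.card A := fun a => Fin.is_lt _
  have hnum : Set.InjOn num S := by
    intro p hp q _ h
    exact (List.idxOf_inj (Finset.mem_toList.2 hp)).1 h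
  have hnum' : ∀ q ∈ S, num q < S.card := by
    intro q hq
    rw [← Finset.length_toList]
    exact List.idxOf_lt_length_of_mem (Finset.mem_toList.2 hq)
  -- Machine states are numbered below `S.card`. State `S.card` jumps to the start of the machine,
  -- and the states above it write the input while counting down.
  refine ⟨Fintype.card A, S.card, num f,
    machineEdges num code M S ++ [⟨S.card, .jump, num q₀⟩], code, hnum' f hf, fun word => ?_⟩
  set E := (machineEdges num code M S ++ [⟨S.card, .jump, num q₀⟩]) ++
    inputEdges S.card (word.map code) with hE
  have hmem : ∀ e, e ∈ E ↔ e ∈ machineEdges num code M S ∨ e = ⟨S.card, .jump, num q₀⟩ ∨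
      ∃ u a v, word = u ++ a :: v ∧
        e = ⟨S.card + v.length + 1, .write (code a), S.card + v.length⟩ := by
    intro e
    rw [hE, List.mem_append, List.mem_append, List.mem_singleton, mem_inputEdges_iff, or_assoc]
    refine or_congr_right (or_congr_right ⟨?_, ?_⟩)
    · rintro ⟨u, a, v, h, rfl⟩
      obtain ⟨u', v', rfl, rfl, hv⟩ := List.map_eq_append_iff.1 h
      obtain ⟨a', v'', rfl, rfl, rfl⟩ := List.map_eq_cons_iff.1 hv
      exact ⟨u', a', v'', rfl, by simp⟩
    · rintro ⟨u, a, v, rfl, rfl⟩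
      exact ⟨u.map code, code a, v.map code, by simp, by simp⟩
  constructor
  · intro e he
    rcases (hmem e).1 he with he | rfl | ⟨u, a, v, rfl, rfl⟩
    · exact bounded_machineEdges hcode' (fun q hq => (hnum' q hq).trans_le (by omega)) hS e he
    · exact ⟨by simp, by have := hnum' _ hq₀; simp; omega, trivial⟩
    · refine ⟨?_, ?_, hcode' a⟩ <;> simp <;> omega
  · intro w
    constructor
    · intro h
      -- A run is either still writing the input, with `u` done and `v` left, or already follows the
      -- machine started on `word`. The final state is below `S.card`, which excludes the first
      -- case.
      have key : ∀ c, QueueReaches E (S.card + word.length, []) c →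
          (∃ u v, word = u ++ v ∧ c = (S.card + v.length, u.map code)) ∨
          ∃ q ∈ S, ∃ u, c = (num q, u.map code) ∧ Reaches (queueStep M) (q₀, word) (q, u) := by
        intro c hc
        induction hc with
        | refl => exact Or.inl ⟨[], word, rfl, rfl⟩
        | @tail c d _ hcd ih =>
          obtain ⟨e, he, hsrc, hdst, hact⟩ := hcd
          rcases ih with ⟨u, v, rfl, rfl⟩ | ⟨q, hq, u, rfl, hr⟩
          · rcases (hmem e).1 he with he | rfl | ⟨u', a, v', h, rfl⟩
            · have := (bounded_machineEdges hcode' hnum' hS e he).1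
              simp only at hsrc
              omega
            · simp only at hsrc hdst hact
              obtain rfl : v = [] := List.length_eq_zero_iff.1 (by omega)
              obtain ⟨d₁, d₂⟩ := d
              simp only at hdst hact
              cases hact
              subst hdst
              exact Or.inr ⟨q₀, hq₀, u, rfl, by rw [List.append_nil]; exact .refl⟩
            · simp only at hsrc hdst hact
              obtain ⟨rfl, rfl⟩ := List.append_inj' h (by simp; omega)
              obtain ⟨d₁, d₂⟩ := d
              simp only at hdst hact
              cases hact
              subst hdst
              exact Or.inl ⟨u ++ [a], v', by simp, by simp⟩
          · have hlt := hnum' q hq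
            rcases (hmem e).1 he with he | rfl | ⟨u', a, v', h, rfl⟩
            · obtain ⟨c, hc, rfl⟩ := exists_queueStep_of_machineEdges hcode hnum hq he hsrc hdst
                hact
              exact Or.inr ⟨c.1, queueStep_mem (S := (S : Set Q)) hS hq hc, c.2, rfl, hr.tail hc⟩
            · simp only at hsrc
              omega
            · simp only at hsrc
              omega
      rcases key _ h with ⟨u, v, _, h⟩ | ⟨q, hq, u, h, hr⟩
      · have := hnum' f hf
        simp only [Prod.mk.injEq] at h
        omega
      · simp only [Prod.mk.injEq] at h
        obtain rfl := hnum hf hq h.1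
        exact ⟨u, h.2, hr⟩
    · rintro ⟨u, rfl, h⟩
      have h1 : QueueReaches E (S.card + word.length, []) (S.card, word.map code) := by
        have := queueReaches_inputEdges (s := S.card) (w := word.map code) (E := E)
          (List.subset_append_right _ _) [] (word.map code) rfl
        simpa using this
      have h2 : QueueStep E (S.card, word.map code) (num q₀, word.map code) :=
        ⟨_, (hmem _).2 (Or.inr (Or.inl rfl)), rfl, rfl, .jump _⟩
      have h3 : ∀ c, Reaches (queueStep M) (q₀, word) c → c.1 ∈ S ∧
          QueueReaches E (num q₀, word.map code) (num c.1, c.2.map code) := by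
        intro c hc
        induction hc with
        | refl => exact ⟨hq₀, .refl⟩
        | tail _ hcd ih =>
          refine ⟨queueStep_mem (S := (S : Set Q)) hS ih.1 hcd, ih.2.tail ?_⟩
          exact queueStep_machineEdges (fun e he => (hmem e).2 (Or.inl he)) ih.1 hcd
      exact (h1.tail h2).trans (h3 _ h).2

/-! ### An undecidable halting problem for stack machines -/

/-- The code is fixed and only its input varies: it evaluates program number `n` on 0. Deciding its
halting would decide the halting problem. -/
theorem exists_code_halting :
    ∃ c : ToPartrec.Code, ¬ ComputablePred fun n : ℕ => (c.eval [n]).Dom := by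
  have hp : Partrec fun n : ℕ => (Denumerable.ofNat Nat.Partrec.Code n).eval 0 :=
    Nat.Partrec.Code.eval_part.comp (Computable.ofNat _) (Computable.const 0)
  obtain ⟨c, hc⟩ := ToPartrec.Code.exists_code (Nat.Partrec'.part_iff₁.2 hp)
  refine ⟨c, fun h => ComputablePred.halting_problem 0 ?_⟩
  have h' : ComputablePred fun d : Nat.Partrec.Code => (c.eval [Encodable.encode d]).Dom := by
    obtain ⟨f, hf, h⟩ := ComputablePred.computable_iff.1 h
    refine ComputablePred.computable_iff.2 ⟨_, hf.comp Computable.encode, ?_⟩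
    funext d
    exact congrFun h (Encodable.encode d)
  convert h' using 2 with d
  have hd : c.eval [Encodable.encode d] = pure <$> d.eval 0 := by
    have := hc ⟨[Encodable.encode d], rfl⟩
    rwa [show List.Vector.head ⟨[Encodable.encode d], rfl⟩ = Encodable.encode d from rfl,
      Denumerable.ofNat_encode] at this
  rw [hd]
  rfl

/-- Digits are stored least significant first; this is the recursion on `n / 2` that makes the
encoding primitive recursive. -/
theorem trNat_pos {n : ℕ} (hn : 0 < n) : PartrecToTM2.trNat n =
    (if n % 2 = 1 then .bit1 else .bit0) :: PartrecToTM2.trNat (n / 2) := by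
  have key : ∀ p : PosNum, PartrecToTM2.trNat (p : ℕ) = PartrecToTM2.trPosNum p := by
    intro p
    rw [PartrecToTM2.trNat, PosNum.of_to_nat, PartrecToTM2.trNum]
  obtain ⟨p, rfl⟩ : ∃ p : PosNum, (p : ℕ) = n := by
    have h := Num.to_of_nat n
    cases hm : (n : Num) with
    | zero =>
      rw [hm] at h
      exact absurd h hn.ne
    | pos p =>
      rw [hm] at h
      exact ⟨p, h⟩
  rw [key]
  cases p with
  | one => simp [PartrecToTM2.trPosNum]
  | bit0 p =>
    have h1 : (PosNum.bit0 p : ℕ) = p + p := PosNum.cast_bit0 p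
    rw [PartrecToTM2.trPosNum, h1, if_neg (by omega), show ((p : ℕ) + p) / 2 = p by omega, key]
  | bit1 p =>
    have h1 : (PosNum.bit1 p : ℕ) = p + p + 1 := PosNum.cast_bit1 p
    rw [PartrecToTM2.trPosNum, h1, if_pos (by omega), show ((p : ℕ) + p + 1) / 2 = p by omega,
      key]

theorem primrec_map_trNat (h : PartrecToTM2.Γ' → ℕ) :
    Primrec fun n => (PartrecToTM2.trNat n).map h := by
  have : Primrec₂ fun (_ : Unit) n => (PartrecToTM2.trNat n).map h := by
    refine Primrec.nat_strong_rec _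
      -- The list `l` holds the values at all smaller arguments, so `l.length` is the argument
      -- itself.
      (g := fun _ l => some (if l.length = 0 then [] else
        (if l.length % 2 = 1 then h .bit1 else h .bit0) :: l.getD (l.length / 2) [])) ?_ ?_
    · have hl : Primrec fun p : Unit × List (List ℕ) => p.2.length :=
        Primrec.list_length.comp Primrec.snd
      refine Primrec.option_some.comp (Primrec.ite (Primrec.eq.comp hl (Primrec.const 0))
        (Primrec.const []) (Primrec.list_cons.comp (Primrec.ite (Primrec.eq.comp
          (Primrec.nat_mod.comp hl (Primrec.const 2)) (Primrec.const 1)) (Primrec.const _)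
          (Primrec.const _)) ?_))
      exact (Primrec.list_getD []).comp Primrec.snd (Primrec.nat_div.comp hl (Primrec.const 2))
    · intro _ n
      rcases Nat.eq_zero_or_pos n with rfl | hn
      · simp
      · have : n / 2 < n := Nat.div_lt_self hn one_lt_two
        rw [trNat_pos hn]
        simp [hn.ne', List.getD, this]
        split_ifs <;> rfl
  exact this.comp (Primrec.const ()) Primrec.id

instance : Finite PartrecToTM2.K' := by
  refine Finite.of_injective (β := Fin 4)
    (fun | .main => 0 | .rev => 1 | .aux => 2 | .stack => 3) ?_
  intro a b h
  cases a <;> cases b <;> simp at h <;> rfl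

/-- There are queue systems, given by a fixed part and a computable input word, for which the
reachability of a state is undecidable. -/
theorem exists_undecidable_queueSystem :
    ∃ (m s t : ℕ) (F : List QueueEdge) (word : ℕ → List ℕ) (p : ℕ → Prop), t < s ∧
      Primrec word ∧ ¬ ComputablePred p ∧ ∀ n,
        Bounded m (s + (word n).length + 1) (F ++ inputEdges s (word n)) ∧
        ((∃ w, QueueReaches (F ++ inputEdges s (word n)) (s + (word n).length, []) (t, w)) ↔ p n) ∧
        (QueueReaches (F ++ inputEdges s (word n)) (s + (word n).length, []) (t, []) ↔ p n) := by
  classical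
  obtain ⟨c, hc⟩ := exists_code_halting
  -- `TM2.Supports` demands that `default` lie in the set of labels, so `default` has to be the
  -- start label of this code.
  let _ : Inhabited PartrecToTM2.Λ' := ⟨PartrecToTM2.trNormal c .halt⟩
  have hsup := PartrecToTM2.tr_supports c .halt
  have hstart : (some (.run, PartrecToTM2.tr (PartrecToTM2.trNormal c .halt), none) :
      SimState PartrecToTM2.K' PartrecToTM2.Γ' PartrecToTM2.Λ' (Option PartrecToTM2.Γ')) ∈
      simSupport PartrecToTM2.tr (PartrecToTM2.codeSupp c .halt) := by
    rintro _ ⟨⟩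
    exact Finset.some_mem_insertNone.2 (Finset.mem_biUnion.2 ⟨_, hsup.1, TM2.stmts₁_self⟩)
  obtain ⟨m, s, t, F, code, hts, h⟩ := exists_queueSystem (simulator PartrecToTM2.tr)
    (simSupport_finite PartrecToTM2.tr (PartrecToTM2.codeSupp c .halt))
    (simulator_succIn PartrecToTM2.tr hsup) hstart (f := none) (by simp [simSupport])
  let u : ℕ → List (PartrecToTM2.K' × PartrecToTM2.Γ') :=
    fun n => (PartrecToTM2.trList [n]).map fun g => (.main, g)
  refine ⟨m, s, t, F, fun n => (marked (u n)).map code, _, hts, ?_, hc, fun n => ?_⟩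
  -- `trList [n]` is `trNat n` followed by the separator `cons`.
  · have := Primrec.list_append.comp (primrec_map_trNat fun g => code (some (.main, g)))
      (Primrec.const [code (some (.main, .cons))])
    refine this.of_eq fun n => ?_
    simp [marked, u, Function.comp_def]
  · have hrel : SimRel PartrecToTM2.tr (PartrecToTM2.init c [n])
        (some (.run, PartrecToTM2.tr (PartrecToTM2.trNormal c .halt), none), marked (u n)) := by
      refine ⟨rfl, u n, rfl, fun k => ?_⟩
      cases k <;> simp [u, stackOf, List.filterMap_map, PartrecToTM2.init]
    obtain ⟨h1, h2⟩ := exists_reaches_none_iff PartrecToTM2.tr hrel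
    have hdom : (eval (TM2.step PartrecToTM2.tr) (PartrecToTM2.init c [n])).Dom ↔
        (c.eval [n]).Dom := by
      rw [PartrecToTM2.tr_eval]
      simp
    rw [hdom] at h1 h2
    obtain ⟨hb, hr⟩ := h (marked (u n))
    simp only [List.length_map]
    refine ⟨hb, ?_, ?_⟩
    · rw [← h1]
      simp only [hr]
      exact ⟨fun ⟨_, v, _, hv⟩ => ⟨v, hv⟩, fun ⟨v, hv⟩ => ⟨_, v, rfl, hv⟩⟩
    · rw [← h2, hr]
      exact ⟨fun ⟨v, hv, h⟩ => by rwa [List.map_eq_nil_iff.1 hv.symm] at h,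
        fun h => ⟨[], rfl, h⟩⟩

/-! ### Computability of the reduction -/

theorem flatMap_edges_inputEdges (m s : ℕ) (w : List ℕ) :
    (inputEdges s w).flatMap (QueueEdge.edges m) = (withDistance w).map fun p =>
      ⟨2 * (s + p.1 + 1), [], .send 1 p.2, allClocks m, 2 * (s + p.1)⟩ := by
  rw [inputEdges, List.flatMap_map, List.map_eq_flatMap]
  rfl

theorem primrec_withDistance : Primrec withDistance := by
  refine Primrec.list_foldr (h := fun _ p => (p.2.length, p.1) :: p.2) Primrec.id
    (Primrec.const []) ?_
  exact Primrec.list_cons.comp (Primrec.pair (Primrec.list_length.comp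
    (Primrec.snd.comp Primrec.snd)) (Primrec.fst.comp Primrec.snd))
    (Primrec.snd.comp Primrec.snd)

/-- The list `F` is independent of `n` and enters as a constant, no matter how it was obtained. Only
the input edges, the number of locations and the initial location vary. -/
theorem primrec_queueCTA (m s : ℕ) (F : List QueueEdge) {word : ℕ → List ℕ}
    (hw : Primrec word) : Primrec fun n => queueCTA m (s + (word n).length + 1)
      (s + (word n).length) ((F ++ inputEdges s (word n)).flatMap (QueueEdge.edges m)) := by
  have hlen : Primrec fun n => s + (word n).length :=
    Primrec.nat_add.comp (Primrec.const s) (Primrec.list_length.comp hw)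
  have hdouble : Primrec fun n : ℕ => 2 * n := Primrec.nat_mul.comp (Primrec.const 2) Primrec.id
  have hsrc : Primrec fun p : ℕ × ℕ => 2 * (s + p.1) :=
    hdouble.comp (Primrec.nat_add.comp (Primrec.const s) Primrec.fst)
  have hdst : Primrec fun p : ℕ × ℕ => 2 * (s + p.1 + 1) :=
    hdouble.comp (Primrec.succ.comp (Primrec.nat_add.comp (Primrec.const s) Primrec.fst))
  have hop : Primrec fun p : ℕ × ℕ => Op.send 1 p.2 :=
    (Primrec.of_equiv_symm (e := Op.equiv)).comp (Primrec.sumInr.comp (Primrec.sumInl.comp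
      (Primrec.pair (Primrec.const 1) Primrec.snd)))
  have hedge : Primrec fun p : ℕ × ℕ =>
      (⟨2 * (s + p.1 + 1), [], .send 1 p.2, allClocks m, 2 * (s + p.1)⟩ : Edge) :=
    (Primrec.of_equiv_symm (e := Edge.equiv)).comp (Primrec.pair hdst
      (Primrec.pair (Primrec.const []) (Primrec.pair hop (Primrec.pair
        (Primrec.const (allClocks m)) hsrc))))
  have hedges : Primrec fun n =>
      (F ++ inputEdges s (word n)).flatMap (QueueEdge.edges m) := by
    simp only [List.flatMap_append, flatMap_edges_inputEdges]
    exact Primrec.list_append.comp (Primrec.const _)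
      (Primrec.list_map (primrec_withDistance.comp hw) (hedge.comp Primrec.snd).to₂)
  have hsingle {α : Type} [Primcodable α] {f : ℕ → α} (hf : Primrec f) :
      Primrec fun n => [f n] := Primrec.list_cons.comp hf (Primrec.const [])
  have hwriter : Primrec fun n => writer (s + (word n).length + 1) (s + (word n).length)
      ((F ++ inputEdges s (word n)).flatMap (QueueEdge.edges m)) :=
    (Primrec.of_equiv_symm (e := TimedAutomaton.equiv)).comp (Primrec.pair
      (hdouble.comp (Primrec.succ.comp hlen)) (Primrec.pair (hsingle (hdouble.comp hlen))
        (Primrec.pair (Primrec.const 0) (Primrec.pair hedges (Primrec.const [])))))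
  exact (Primrec.of_equiv_symm (e := CTA.equiv)).comp (Primrec.pair
    (Primrec.list_cons.comp hwriter (Primrec.const [reader m]))
    (Primrec.const ([(0, 1)], m, m + 1)))

/-! ### Transfer of undecidability along the reduction -/

theorem DecidableOn.computablePred {α : Type*} [Primcodable α] {valid p : α → Prop}
    (h : DecidableOn valid p) {g : ℕ → α} (hg : Computable g) (hv : ∀ n, valid (g n)) :
    ComputablePred fun n => p (g n) := by
  obtain ⟨f, hf, h⟩ := h
  refine ComputablePred.computable_iff.2 ⟨_, hf.comp hg, ?_⟩
  funext n
  exact propext (h _ (hv n)).symm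

end CommTA

theorem theorem1 :
    ¬ CommTA.DecidableOn CommTA.LocInstance.Valid CommTA.LocInstance.Reachable ∧
      ¬ CommTA.DecidableOn CommTA.ConfigInstance.Valid CommTA.ConfigInstance.Reachable := by
  obtain ⟨m, s, t, F, word, p, hts, hw, hp, h⟩ := CommTA.exists_undecidable_queueSystem
  have hcta := CommTA.primrec_queueCTA m s F hw
  have hstart : Primrec fun n => [2 * (s + (word n).length), 0] :=
    Primrec.list_cons.comp (Primrec.nat_mul.comp (Primrec.const 2) (Primrec.nat_add.comp
      (Primrec.const s) (Primrec.list_length.comp hw))) (Primrec.const [0])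
  constructor
  · intro hd
    refine hp ((hd.computablePred ((Primrec.of_equiv_symm (e := CommTA.LocInstance.equiv)).comp
      (hcta.pair (hstart.pair (Primrec.const (0, 2 * t))))).to_comp ?_).of_eq ?_)
    · intro n
      refine ⟨CommTA.queueCTA_twoOneChannel (h n).1 (Nat.lt_succ_self _),
        CommTA.queueCTA_isStart _ _ _ _, _, rfl, ?_⟩
      simp only [CommTA.LocInstance.equiv, CommTA.writer, Equiv.coe_fn_symm_mk]
      omega
    · intro n
      exact (CommTA.exists_loc_iff (h n).1).trans (h n).2.1
  · intro hd
    refine hp ((hd.computablePred ((Primrec.of_equiv_symm (e := CommTA.ConfigInstance.equiv)).comp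
      (hcta.pair (hstart.pair (Primrec.const (CommTA.cleared m t))))).to_comp ?_).of_eq ?_)
    · intro n
      exact ⟨CommTA.queueCTA_twoOneChannel (h n).1 (Nat.lt_succ_self _),
        CommTA.queueCTA_isStart _ _ _ _, CommTA.exists_isConfig_cleared _ (by omega)⟩
    · intro n
      exact (CommTA.exists_data_iff (h n).1).trans (h n).2.2
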